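/- Let $G=S_3$. The double Burnside ring $B(G,G)$ is the Grothendieck group of finite $(G,G)$-bisets (addition: disjoint union; multiplication: tensor product $X\times_G Y=(X\times Y)/G$, where $(x,y).g=(x.g,g^{-1}.y)$), and $\mathbb{Q}B(G,G)=\mathbb{Q}\otimes_{\mathbb{Z}}B(G,G)$. For $L\le G\times G$ let $[G\times G/L]$ be the class of the set of left cosets of $L$ with the biset structure $g\cdot z\cdot h=(g,h^{-1})z$. The Goursat sections of $L$ are $(p_i(L),k_i(L))$, $i=1,2$, where $p_1,p_2$ are the two projections of $L$, $k_1(L)=\{g:(g,1)\in L\}$ and $k_2(L)=\{g:(1,g)\in L\}$. Write $2$ and $3$ for a subgroup of $G$ of order $2$ and $3$. Let $L_1,\dots,L_{22}$ be subgroups of $G\times G$ such that the Goursat sections of $L_i$ are conjugate to the following row label (first section) and column label (second section): \[ \begin{array}{r|cccc} & (1,1)&(2,2)&(3,3)&(G,G)\\\hline (1,1)&L_1&L_2&L_3&L_4\\(2,2)&L_5&L_6&L_7&L_8\\(3,3)&L_9&L_{10}&L_{11}&L_{12}\\(G,G)&L_{13}&L_{14}&L_{15}&L_{16}\end{array} \qquad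 \begin{array}{r|cccc} & (2,1)&(G,3)&(3,1)&(G,1)\\\hline (2,1)&L_{17}&L_{18}&&\\(G,3)&L_{19}&L_{20}&&\\(3,1)&&&L_{21}&\\(G,1)&&&&L_{22}\end{array} \] (these represent the $22$ conjugacy classes of subgroups of $G\times G$). Let $M'=(m'_{ij})\in\mathbb{Q}^{22\times22}$ be the matrix \[ \left(\begin{array}{cccccccccccccccccccccc} 6&\cdot&\cdot&\cdot&\cdot&\cdot&\cdot&\cdot&\cdot&\cdot&\cdot&\cdot&\cdot&\cdot&\cdot&\cdot&\cdot&\cdot&\cdot&\cdot&\cdot&\cdot\\ 3&1&\cdot&\cdot&\cdot&\cdot&\cdot&\cdot&\cdot&\cdot&\cdot&\cdot&\cdot&\cdot&\cdot&\cdot&\cdot&\cdot&\cdot&\cdot&\cdot&\cdot\\ 2&\cdot&2&\cdot&\cdot&\cdot&\cdot&\cdot&\cdot&\cdot&\cdot&\cdot&\cdot&\cdot&\cdot&\cdot&\cdot&\cdot&\cdot&\cdot&\cdot&\cdot\\ 1&1&1&1&\cdot&\cdot&\cdot&\cdot&\cdot&\cdot&\cdot&\cdot&\cdot&\cdot&\cdot&\cdot&\cdot&\cdot&\cdot&\cdot&\cdot&\cdot\\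 3&\cdot&\cdot&\cdot&3&\cdot&\cdot&\cdot&\cdot&\cdot&\cdot&\cdot&\cdot&\cdot&\cdot&\cdot&\cdot&\cdot&\cdot&\cdot&\cdot&\cdot\\ \tfrac{3}{2}&\tfrac{1}{2}&\cdot&\cdot&\tfrac{3}{2}&\tfrac{1}{2}&\cdot&\cdot&\cdot&\cdot&\cdot&\cdot&\cdot&\cdot&\cdot&\cdot&\cdot&\cdot&\cdot&\cdot&\cdot&\cdot\\ 1&\cdot&1&\cdot&1&\cdot&1&\cdot&\cdot&\cdot&\cdot&\cdot&\cdot&\cdot&\cdot&\cdot&\cdot&\cdot&\cdot&\cdot&\cdot&\cdot\\ \tfrac{1}{2}&\tfrac{1}{2}&\tfrac{1}{2}&\tfrac{1}{2}&\tfrac{1}{2}&\tfrac{1}{2}&\tfrac{1}{2}&\tfrac{1}{2}&\cdot&\cdot&\cdot&\cdot&\cdot&\cdot&\cdot&\cdot&\cdot&\cdot&\cdot&\cdot&\cdot&\cdot\\ 2&\cdot&\cdot&\cdot&\cdot&\cdot&\cdot&\cdot&4&\cdot&\cdot&\cdot&\cdot&\cdot&\cdot&\cdot&\cdot&\cdot&\cdot&\cdot&\cdot&\cdot\\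 1&\tfrac{1}{3}&\cdot&\cdot&\cdot&\cdot&\cdot&\cdot&2&\tfrac{2}{3}&\cdot&\cdot&\cdot&\cdot&\cdot&\cdot&\cdot&\cdot&\cdot&\cdot&\cdot&\cdot\\ \tfrac{2}{3}&\cdot&\tfrac{2}{3}&\cdot&\cdot&\cdot&\cdot&\cdot&\tfrac{4}{3}&\cdot&\tfrac{4}{3}&\cdot&\cdot&\cdot&\cdot&\cdot&\cdot&\cdot&\cdot&\cdot&\cdot&\cdot\\ \tfrac{1}{3}&\tfrac{1}{3}&\tfrac{1}{3}&\tfrac{1}{3}&\cdot&\cdot&\cdot&\cdot&\tfrac{2}{3}&\tfrac{2}{3}&\tfrac{2}{3}&\tfrac{2}{3}&\cdot&\cdot&\cdot&\cdot&\cdot&\cdot&\cdot&\cdot&\cdot&\cdot\\ 1&\cdot&\cdot&\cdot&3&\cdot&\cdot&\cdot&2&\cdot&\cdot&\cdot&6&\cdot&\cdot&\cdot&\cdot&\cdot&\cdot&\cdot&\cdot&\cdot\\ \tfrac{1}{2}&\tfrac{1}{6}&\cdot&\cdot&\tfrac{3}{2}&\tfrac{1}{2}&\cdot&\cdot&1&\tfrac{1}{3}&\cdot&\cdot&3&1&\cdot&\cdot&\cdot&\cdot&\cdot&\cdot&\cdot&\cdot\\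 \tfrac{1}{3}&\cdot&\tfrac{1}{3}&\cdot&1&\cdot&1&\cdot&\tfrac{2}{3}&\cdot&\tfrac{2}{3}&\cdot&2&\cdot&2&\cdot&\cdot&\cdot&\cdot&\cdot&\cdot&\cdot\\ \tfrac{1}{6}&\tfrac{1}{6}&\tfrac{1}{6}&\tfrac{1}{6}&\tfrac{1}{2}&\tfrac{1}{2}&\tfrac{1}{2}&\tfrac{1}{2}&\tfrac{1}{3}&\tfrac{1}{3}&\tfrac{1}{3}&\tfrac{1}{3}&1&1&1&1&\cdot&\cdot&\cdot&\cdot&\cdot&\cdot\\ 3&\cdot&\cdot&\cdot&\cdot&1&\cdot&\cdot&\cdot&\cdot&\cdot&\cdot&\cdot&\cdot&\cdot&\cdot&1&\cdot&\cdot&\cdot&\cdot&\cdot\\ 1&\cdot&1&\cdot&\cdot&1&\cdot&1&\cdot&\cdot&\cdot&\cdot&\cdot&\cdot&\cdot&\cdot&1&1&\cdot&\cdot&\cdot&\cdot\\ 1&\cdot&\cdot&\cdot&\cdot&1&\cdot&\cdot&2&\cdot&\cdot&\cdot&\cdot&2&\cdot&\cdot&1&\cdot&2&\cdot&\cdot&\cdot\\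 \tfrac{1}{3}&\cdot&\tfrac{1}{3}&\cdot&\cdot&1&\cdot&1&\tfrac{2}{3}&\cdot&\tfrac{2}{3}&\cdot&\cdot&2&\cdot&2&1&1&2&2&\cdot&\cdot\\ 2&\cdot&\cdot&\cdot&\cdot&\cdot&\cdot&\cdot&\cdot&\cdot&2&\cdot&\cdot&\cdot&\cdot&\cdot&\cdot&\cdot&\cdot&\cdot&2&\cdot\\ 1&\cdot&\cdot&\cdot&\cdot&1&\cdot&\cdot&\cdot&\cdot&1&\cdot&\cdot&\cdot&\cdot&\cdot&1&\cdot&\cdot&\cdot&1&1 \end{array}\right) \] where dots denote zeros. \textbf{Theorem (mark homomorphism for $\mathbb{Q}B(S_3,S_3)$).} The elements $b_i=[G\times G/L_i]$, $1\le i\le 22$, form a $\mathbb{Q}$-basis of $\mathbb{Q}B(G,G)$; the matrix $M'$ is invertible; there are unique elements $c_1,\dots,c_{22}\in\mathbb{Q}B(G,G)$ with $b_i=\sum_{j}m'_{ij}c_j$ for all $i$, and they form a $\mathbb{Q}$-basis of $\mathbb{Q}B(G,G)$. The linear map $\beta'\colon\mathbb{Q}B(G,G)\to\mathbb{Q}^{8\times8}$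 defined by \[ \beta'\Bigl(\sum_{i=1}^{22}x_ic_i\Bigr)=\begin{pmatrix} x_1&x_2&x_3&x_4&0&0&0&0\\ x_5&x_6&x_7&x_8&0&0&0&0\\ x_9&x_{10}&x_{11}&x_{12}&0&0&0&0\\ 0&0&0&x_{22}&0&0&0&0\\ 0&0&0&0&x_{17}&x_{18}&0&0\\ 0&0&0&0&0&x_{22}&0&0\\ 0&0&0&0&0&0&x_{21}&0\\ x_{13}&x_{14}&x_{15}&x_{16}&x_{19}&x_{20}&0&x_{22} \end{pmatrix}\qquad(x_i\in\mathbb{Q}) \] is an injective (unital) homomorphism of $\mathbb{Q}$-algebras. -/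

import Mathlib

/-! ### Finite bisets -/

/-- A finite `(G, H)`-biset: a finite set with a left action of `G` and a right action of `H`
(that is, an action of the opposite group `Hᵐᵒᵖ`) which commute with each other. -/
structure Biset (G H : Type) [Group G] [Group H] where
  carrier : Type
  [finite : Finite carrier]
  [left : MulAction G carrier]
  [right : MulAction Hᵐᵒᵖ carrier]
  [comm : SMulCommClass G Hᵐᵒᵖ carrier]

namespace Biset

attribute [instance] Biset.finite Biset.left Biset.right Biset.comm

variable {G H K J : Type} [Group G] [Group H] [Group K] [Group J]

/-- The right action `x · h`. -/
def act (X : Biset G H) (x : X.carrier) (h : H) : X.carrier := MulOpposite.op h • x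

theorem act_one (X : Biset G H) (x : X.carrier) : X.act x 1 = x := by
  simp [act]

theorem act_mul (X : Biset G H) (x : X.carrier) (h k : H) :
    X.act x (h * k) = X.act (X.act x h) k := by
  simp [act, mul_smul]

theorem smul_act (X : Biset G H) (g : G) (x : X.carrier) (h : H) :
    g • X.act x h = X.act (g • x) h :=
  smul_comm g (MulOpposite.op h) x

/-- Isomorphism of bisets: a bijection that is compatible with both actions. -/
def Iso (X Y : Biset G H) : Prop :=
  ∃ e : X.carrier ≃ Y.carrier,
    (∀ (g : G) (x : X.carrier), e (g • x) = g • e x) ∧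
    (∀ (x : X.carrier) (h : H), e (X.act x h) = Y.act (e x) h)

theorem Iso.refl (X : Biset G H) : Iso X X :=
  ⟨Equiv.refl _, fun _ _ => rfl, fun _ _ => rfl⟩

theorem Iso.symm {X Y : Biset G H} : Iso X Y → Iso Y X := by
  rintro ⟨e, h1, h2⟩
  refine ⟨e.symm, fun g x => ?_, fun x h => ?_⟩
  · rw [Equiv.symm_apply_eq, h1, Equiv.apply_symm_apply]
  · rw [Equiv.symm_apply_eq, h2, Equiv.apply_symm_apply]

theorem Iso.trans {X Y Z : Biset G H} : Iso X Y → Iso Y Z → Iso X Z := by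
  rintro ⟨e, h1, h2⟩ ⟨f, k1, k2⟩
  exact ⟨e.trans f, fun g x => by simp [h1, k1], fun x h => by simp [h2, k2]⟩

/-- The setoid of isomorphism of bisets. -/
instance isoSetoid (G H : Type) [Group G] [Group H] : Setoid (Biset G H) where
  r := Iso
  iseqv := ⟨Iso.refl, Iso.symm, Iso.trans⟩

/-- Disjoint union of two bisets. -/
def sum (X Y : Biset G H) : Biset G H where
  carrier := X.carrier ⊕ Y.carrier
  left :=
    { smul := fun g => Sum.map (g • ·) (g • ·)
      one_smul := by rintro (x | y) <;> simp [HSMul.hSMul] <;> exact one_smul _ _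
      mul_smul := by rintro g h (x | y) <;> simp [HSMul.hSMul] <;> exact mul_smul _ _ _ }
  right :=
    { smul := fun g => Sum.map (g • ·) (g • ·)
      one_smul := by rintro (x | y) <;> simp [HSMul.hSMul] <;> exact one_smul _ _
      mul_smul := by rintro g h (x | y) <;> simp [HSMul.hSMul] <;> exact mul_smul _ _ _ }
  comm := ⟨by
    rintro g h (x | y)
    · exact congrArg Sum.inl (smul_comm g h x)
    · exact congrArg Sum.inr (smul_comm g h y)⟩

/-- The empty biset. -/
def empty (G H : Type) [Group G] [Group H] : Biset G H where
  carrier := Empty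
  left := { smul := fun _ x => x, one_smul := fun _ => rfl, mul_smul := fun _ _ _ => rfl }
  right := { smul := fun _ x => x, one_smul := fun _ => rfl, mul_smul := fun _ _ _ => rfl }
  comm := @SMulCommClass.mk _ _ _ (_) (_) fun _ _ x => x.elim

/-- The orbit relation on `X × Y` of the action `(x, y).h = (x.h, h⁻¹.y)` of `H`. -/
def tensorSetoid (X : Biset G H) (Y : Biset H K) : Setoid (X.carrier × Y.carrier) where
  r p q := ∃ h : H, q = (X.act p.1 h, h⁻¹ • p.2)
  iseqv :=
    { refl := fun p => ⟨1, by simp [act_one]⟩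
      symm := by
        rintro p q ⟨h, rfl⟩
        exact ⟨h⁻¹, by simp [← act_mul, act_one]⟩
      trans := by
        rintro p q r ⟨h, rfl⟩ ⟨k, rfl⟩
        exact ⟨h * k, by simp [act_mul, mul_smul]⟩ }

/-- The tensor product `X ×_H Y = (X × Y) / H` of bisets. -/
def tensor (X : Biset G H) (Y : Biset H K) : Biset G K where
  carrier := Quotient (tensorSetoid X Y)
  finite := Quotient.finite _
  left :=
    { smul := fun g => Quotient.map (fun p => (g • p.1, p.2)) (by
        rintro p q ⟨h, rfl⟩
        exact ⟨h, by simp [smul_act]⟩)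
      one_smul := by
        rintro ⟨x, y⟩
        exact congrArg (Quotient.mk _) (Prod.ext (one_smul G x) rfl)
      mul_smul := by
        rintro g h ⟨x, y⟩
        exact congrArg (Quotient.mk _) (Prod.ext (mul_smul g h x) rfl) }
  right :=
    { smul := fun k => Quotient.map (fun p => (p.1, k • p.2)) (by
        rintro p q ⟨h, rfl⟩
        exact ⟨h, by simp [smul_comm]⟩)
      one_smul := by
        rintro ⟨x, y⟩
        exact congrArg (Quotient.mk _) (Prod.ext rfl (one_smul Kᵐᵒᵖ y))
      mul_smul := by
        rintro g h ⟨x, y⟩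
        exact congrArg (Quotient.mk _) (Prod.ext rfl (mul_smul g h y)) }
  comm := @SMulCommClass.mk _ _ _ (_) (_) (by rintro g k ⟨x, y⟩; rfl)

/-- The class of `(x, y)` in `X ×_H Y`. -/
def tmk (X : Biset G H) (Y : Biset H K) (x : X.carrier) (y : Y.carrier) :
    (tensor X Y).carrier :=
  Quotient.mk (tensorSetoid X Y) (x, y)

theorem tmk_act (X : Biset G H) (Y : Biset H K) (x : X.carrier) (h : H) (y : Y.carrier) :
    tmk X Y (X.act x h) y = tmk X Y x (h • y) :=
  Quotient.sound ⟨h⁻¹, by simp [← act_mul, act_one]⟩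

theorem tensor_ind {X : Biset G H} {Y : Biset H K} {p : (tensor X Y).carrier → Prop}
    (h : ∀ x y, p (tmk X Y x y)) (z : (tensor X Y).carrier) : p z :=
  Quotient.inductionOn z fun q => h q.1 q.2

/-- A balanced function on `X × Y` factors through `X ×_H Y`. -/
def tlift {X : Biset G H} {Y : Biset H K} {T : Type} (f : X.carrier → Y.carrier → T)
    (hf : ∀ x h y, f (X.act x h) y = f x (h • y)) : (tensor X Y).carrier → T :=
  Quotient.lift (fun p : X.carrier × Y.carrier => f p.1 p.2) (by
    rintro p q ⟨h, rfl⟩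
    simp [hf])

/-- The regular `(G, G)`-biset `G`. -/
def regular (G : Type) [Group G] [Finite G] : Biset G G where
  carrier := G

/-- The transitive `(G, H)`-biset `[G × H / L]`: the `G × H`-set of cosets of `L`, regarded
as a biset through `g · z · h = (g, h⁻¹) z`. -/
def coset [Finite G] [Finite H] (L : Subgroup (G × H)) : Biset G H where
  carrier := (G × H) ⧸ L
  left :=
    { smul := fun g z => ((g, 1) : G × H) • z
      one_smul := fun z => one_smul (G × H) z
      mul_smul := fun g h z => by
        change ((g * h, 1) : G × H) • z = ((g, 1) : G × H) • ((h, 1) : G × H) • z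
        rw [← mul_smul]; simp }
  right :=
    { smul := fun h z => ((1, h.unop⁻¹) : G × H) • z
      one_smul := fun z => by
        change ((1, (1 : H)⁻¹) : G × H) • z = z
        rw [inv_one]; exact one_smul (G × H) z
      mul_smul := fun h k z => by
        change ((1, (k.unop * h.unop)⁻¹) : G × H) • z
          = ((1, h.unop⁻¹) : G × H) • ((1, k.unop⁻¹) : G × H) • z
        rw [← mul_smul]; simp }
  comm := @SMulCommClass.mk _ _ _ (_) (_) fun g h z => by
    change ((g, 1) : G × H) • ((1, h.unop⁻¹) : G × H) • z
      = ((1, h.unop⁻¹) : G × H) • ((g, 1) : G × H) • z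
    rw [← mul_smul, ← mul_smul]; simp

/-! Compatibility of the operations with isomorphism, and the semiring laws up to isomorphism. -/

theorem Iso.of_maps {X Y : Biset G H} (f : X.carrier → Y.carrier) (k : Y.carrier → X.carrier)
    (hkf : ∀ x, k (f x) = x) (hfk : ∀ y, f (k y) = y) (h1 : ∀ (g : G) x, f (g • x) = g • f x)
    (h2 : ∀ x (h : H), f (X.act x h) = Y.act (f x) h) : Iso X Y :=
  ⟨⟨f, k, hkf, hfk⟩, h1, h2⟩

theorem sum_congr {X X' Y Y' : Biset G H} : Iso X X' → Iso Y Y' → Iso (sum X Y) (sum X' Y') := by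
  rintro ⟨e, h1, h2⟩ ⟨f, k1, k2⟩
  refine ⟨Equiv.sumCongr e f, ?_, ?_⟩
  · rintro g (x | y)
    · exact congrArg Sum.inl (h1 g x)
    · exact congrArg Sum.inr (k1 g y)
  · rintro (x | y) g
    · exact congrArg Sum.inl (h2 x g)
    · exact congrArg Sum.inr (k2 y g)

theorem sum_comm (X Y : Biset G H) : Iso (sum X Y) (sum Y X) := by
  refine ⟨Equiv.sumComm _ _, ?_, ?_⟩
  · rintro g (x | y) <;> rfl
  · rintro (x | y) g <;> rfl

theorem sum_assoc (X Y Z : Biset G H) : Iso (sum (sum X Y) Z) (sum X (sum Y Z)) := by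
  refine ⟨Equiv.sumAssoc _ _ _, ?_, ?_⟩
  · rintro g ((x | y) | z) <;> rfl
  · rintro ((x | y) | z) g <;> rfl

theorem empty_sum (X : Biset G H) : Iso (sum (empty G H) X) X := by
  refine ⟨Equiv.emptySum Empty _, ?_, ?_⟩
  · rintro g (x | y)
    · exact x.elim
    · rfl
  · rintro (x | y) g
    · exact x.elim
    · rfl

theorem tensor_congr {X X' : Biset G H} {Y Y' : Biset H K} :
    Iso X X' → Iso Y Y' → Iso (tensor X Y) (tensor X' Y') := by
  rintro ⟨e, h1, h2⟩ ⟨f, k1, k2⟩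
  have h2' : ∀ x h, e.symm (X'.act x h) = X.act (e.symm x) h := fun x h => by
    rw [Equiv.symm_apply_eq, h2, Equiv.apply_symm_apply]
  have k1' : ∀ (g : H) y, f.symm (g • y) = g • f.symm y := fun g y => by
    rw [Equiv.symm_apply_eq, k1, Equiv.apply_symm_apply]
  let F : (tensor X Y).carrier → (tensor X' Y').carrier :=
    tlift (fun x y => tmk X' Y' (e x) (f y)) fun x h y => by rw [h2, k1, tmk_act]
  let F' : (tensor X' Y').carrier → (tensor X Y).carrier :=
    tlift (fun x y => tmk X Y (e.symm x) (f.symm y)) fun x h y => by rw [h2', k1', tmk_act]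
  refine Iso.of_maps F F' ?_ ?_ ?_ ?_
  · exact tensor_ind fun x y => congrArg₂ (tmk X Y) (e.symm_apply_apply x) (f.symm_apply_apply y)
  · exact tensor_ind fun x y =>
      congrArg₂ (tmk X' Y') (e.apply_symm_apply x) (f.apply_symm_apply y)
  · intro g
    exact tensor_ind fun x y => congrArg₂ (tmk X' Y') (h1 g x) rfl
  · intro z g
    exact tensor_ind (p := fun z => F ((tensor X Y).act z g) = (tensor X' Y').act (F z) g)
      (fun x y => congrArg₂ (tmk X' Y') rfl (k2 y g)) z

theorem tensor_assoc (X : Biset G H) (Y : Biset H K) (Z : Biset K J) :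
    Iso (tensor (tensor X Y) Z) (tensor X (tensor Y Z)) := by
  let A (z : Z.carrier) : (tensor X Y).carrier → (tensor X (tensor Y Z)).carrier :=
    tlift (fun x y => tmk X (tensor Y Z) x (tmk Y Z y z))
      fun x h y => tmk_act X (tensor Y Z) x h (tmk Y Z y z)
  let F : (tensor (tensor X Y) Z).carrier → (tensor X (tensor Y Z)).carrier :=
    tlift (fun p z => A z p) fun p k z =>
      tensor_ind (p := fun p => A z ((tensor X Y).act p k) = A (k • z) p)
        (fun x y => congrArg (tmk X (tensor Y Z) x) (tmk_act Y Z y k z)) p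
  let A' (x : X.carrier) : (tensor Y Z).carrier → (tensor (tensor X Y) Z).carrier :=
    tlift (fun y z => tmk (tensor X Y) Z (tmk X Y x y) z)
      fun y k z => tmk_act (tensor X Y) Z (tmk X Y x y) k z
  let F' : (tensor X (tensor Y Z)).carrier → (tensor (tensor X Y) Z).carrier :=
    tlift (fun x q => A' x q) fun x h q =>
      tensor_ind (p := fun q => A' (X.act x h) q = A' x (h • q))
        (fun y z => congrArg (fun w => tmk (tensor X Y) Z w z) (tmk_act X Y x h y)) q
  refine Iso.of_maps F F' ?_ ?_ ?_ ?_
  · exact tensor_ind fun p z => tensor_ind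
      (p := fun p => F' (F (tmk (tensor X Y) Z p z)) = tmk (tensor X Y) Z p z)
      (fun _ _ => rfl) p
  · exact tensor_ind fun x q => tensor_ind
      (p := fun q => F (F' (tmk X (tensor Y Z) x q)) = tmk X (tensor Y Z) x q)
      (fun _ _ => rfl) q
  · intro g
    exact tensor_ind fun p z => tensor_ind
      (p := fun p => F (g • tmk (tensor X Y) Z p z) = g • F (tmk (tensor X Y) Z p z))
      (fun _ _ => rfl) p
  · intro w g
    refine tensor_ind
      (p := fun w => F ((tensor (tensor X Y) Z).act w g)
        = (tensor X (tensor Y Z)).act (F w) g) (fun p z => ?_) w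
    exact tensor_ind
      (p := fun p => F ((tensor (tensor X Y) Z).act (tmk (tensor X Y) Z p z) g)
        = (tensor X (tensor Y Z)).act (F (tmk (tensor X Y) Z p z)) g)
      (fun _ _ => rfl) p

theorem regular_tensor [Finite G] (X : Biset G H) : Iso (tensor (regular G) X) X := by
  let F : (tensor (regular G) X).carrier → X.carrier :=
    tlift (fun (g : G) x => g • x) fun (g h : G) x => mul_smul g h x
  let F' : X.carrier → (tensor (regular G) X).carrier := fun x => tmk (regular G) X (1 : G) x
  refine Iso.of_maps F F' ?_ ?_ ?_ ?_
  · refine tensor_ind fun (g : G) x => ?_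
    exact (tmk_act (regular G) X (1 : G) g x).symm.trans
      (congrArg (fun a => tmk (regular G) X a x) (one_mul g))
  · exact fun x => one_smul G x
  · intro g
    exact tensor_ind fun (h : G) x => mul_smul g h x
  · intro z g
    exact tensor_ind (p := fun z => F ((tensor (regular G) X).act z g) = X.act (F z) g)
      (fun (h : G) x => smul_act X h x g) z

theorem tensor_regular [Finite H] (X : Biset G H) : Iso (tensor X (regular H)) X := by
  let F : (tensor X (regular H)).carrier → X.carrier :=
    tlift (fun x (h : H) => X.act x h) fun x (h k : H) => (act_mul X x h k).symm
  let F' : X.carrier → (tensor X (regular H)).carrier := fun x => tmk X (regular H) x (1 : H)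
  refine Iso.of_maps F F' ?_ ?_ ?_ ?_
  · refine tensor_ind fun x (h : H) => ?_
    exact (tmk_act X (regular H) x h (1 : H)).trans
      (congrArg (tmk X (regular H) x) (mul_one h))
  · exact fun x => act_one X x
  · intro g
    exact tensor_ind fun x (h : H) => (smul_act X g x h).symm
  · intro z g
    exact tensor_ind (p := fun z => F ((tensor X (regular H)).act z g) = X.act (F z) g)
      (fun x (h : H) => act_mul X x h g) z

theorem tensor_sum (X : Biset G H) (Y Z : Biset H K) :
    Iso (tensor X (sum Y Z)) (sum (tensor X Y) (tensor X Z)) := by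
  let F : (tensor X (sum Y Z)).carrier → (sum (tensor X Y) (tensor X Z)).carrier :=
    tlift (fun x (w : Y.carrier ⊕ Z.carrier) =>
      w.elim (fun y => Sum.inl (tmk X Y x y)) (fun z => Sum.inr (tmk X Z x z))) (by
        rintro x h (y | z)
        · exact congrArg Sum.inl (tmk_act X Y x h y)
        · exact congrArg Sum.inr (tmk_act X Z x h z))
  let F' : (sum (tensor X Y) (tensor X Z)).carrier → (tensor X (sum Y Z)).carrier :=
    fun w : (tensor X Y).carrier ⊕ (tensor X Z).carrier => w.elim
      (tlift (fun x y => tmk X (sum Y Z) x (Sum.inl y))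
        fun x h y => tmk_act X (sum Y Z) x h (Sum.inl y))
      (tlift (fun x z => tmk X (sum Y Z) x (Sum.inr z))
        fun x h z => tmk_act X (sum Y Z) x h (Sum.inr z))
  refine Iso.of_maps F F' ?_ ?_ ?_ ?_
  · refine tensor_ind ?_
    rintro x (y | z) <;> rfl
  · rintro (w | w)
    · exact tensor_ind (X := X) (Y := Y)
        (p := fun w => F (F' (Sum.inl w)) = Sum.inl w) (fun _ _ => rfl) w
    · exact tensor_ind (X := X) (Y := Z)
        (p := fun w => F (F' (Sum.inr w)) = Sum.inr w) (fun _ _ => rfl) w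
  · intro g
    refine tensor_ind ?_
    rintro x (y | z) <;> rfl
  · intro w g
    refine tensor_ind
      (p := fun w => F ((tensor X (sum Y Z)).act w g)
        = (sum (tensor X Y) (tensor X Z)).act (F w) g) ?_ w
    rintro x (y | z) <;> rfl

theorem sum_tensor (X Y : Biset G H) (Z : Biset H K) :
    Iso (tensor (sum X Y) Z) (sum (tensor X Z) (tensor Y Z)) := by
  let F : (tensor (sum X Y) Z).carrier → (sum (tensor X Z) (tensor Y Z)).carrier :=
    tlift (fun (w : X.carrier ⊕ Y.carrier) z =>
      w.elim (fun x => Sum.inl (tmk X Z x z)) (fun y => Sum.inr (tmk Y Z y z))) (by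
        rintro (x | y) h z
        · exact congrArg Sum.inl (tmk_act X Z x h z)
        · exact congrArg Sum.inr (tmk_act Y Z y h z))
  let F' : (sum (tensor X Z) (tensor Y Z)).carrier → (tensor (sum X Y) Z).carrier :=
    fun w : (tensor X Z).carrier ⊕ (tensor Y Z).carrier => w.elim
      (tlift (fun x z => tmk (sum X Y) Z (Sum.inl x) z)
        fun x h z => tmk_act (sum X Y) Z (Sum.inl x) h z)
      (tlift (fun y z => tmk (sum X Y) Z (Sum.inr y) z)
        fun y h z => tmk_act (sum X Y) Z (Sum.inr y) h z)
  refine Iso.of_maps F F' ?_ ?_ ?_ ?_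
  · refine tensor_ind ?_
    rintro (x | y) z <;> rfl
  · rintro (w | w)
    · exact tensor_ind (X := X) (Y := Z)
        (p := fun w => F (F' (Sum.inl w)) = Sum.inl w) (fun _ _ => rfl) w
    · exact tensor_ind (X := Y) (Y := Z)
        (p := fun w => F (F' (Sum.inr w)) = Sum.inr w) (fun _ _ => rfl) w
  · intro g
    refine tensor_ind ?_
    rintro (x | y) z <;> rfl
  · intro w g
    refine tensor_ind
      (p := fun w => F ((tensor (sum X Y) Z).act w g)
        = (sum (tensor X Z) (tensor Y Z)).act (F w) g) ?_ w
    rintro (x | y) z <;> rfl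

theorem empty_iso {X Y : Biset G H} (hX : IsEmpty X.carrier) (hY : IsEmpty Y.carrier) :
    Iso X Y :=
  ⟨Equiv.equivOfIsEmpty _ _, fun _ x => hX.elim x, fun x _ => hX.elim x⟩

theorem empty_tensor (X : Biset H K) : Iso (tensor (empty G H) X) (empty G K) :=
  empty_iso ⟨tensor_ind fun x _ => Empty.elim x⟩ ⟨fun x => Empty.elim x⟩

theorem tensor_empty (X : Biset G H) : Iso (tensor X (empty H K)) (empty G K) :=
  empty_iso ⟨tensor_ind fun _ y => Empty.elim y⟩ ⟨fun x => Empty.elim x⟩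

end Biset

/-! ### The double Burnside ring -/

/-- Isomorphism classes of finite `(G, G)`-bisets. -/
def BisetClass (G : Type) [Group G] : Type 1 := Quotient (Biset.isoSetoid G G)

/-- The isomorphism class of a biset. -/
def BisetClass.mk {G : Type} [Group G] (X : Biset G G) : BisetClass G :=
  Quotient.mk (Biset.isoSetoid G G) X

/-- Isomorphism classes of finite `(G, G)`-bisets form a semiring under disjoint union and
tensor product. -/
instance BisetClass.instSemiring (G : Type) [Group G] [Finite G] : Semiring (BisetClass G) where
  add := Quotient.map₂ Biset.sum fun _ _ h _ _ k => Biset.sum_congr h k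
  zero := Quotient.mk _ (Biset.empty G G)
  mul := Quotient.map₂ Biset.tensor fun _ _ h _ _ k => Biset.tensor_congr h k
  one := Quotient.mk _ (Biset.regular G)
  nsmul := @nsmulRec _ ⟨Quotient.mk _ (Biset.empty G G)⟩
    ⟨Quotient.map₂ Biset.sum fun _ _ h _ _ k => Biset.sum_congr h k⟩
  npow := @npowRec _ ⟨Quotient.mk _ (Biset.regular G)⟩
    ⟨Quotient.map₂ Biset.tensor fun _ _ h _ _ k => Biset.tensor_congr h k⟩
  add_assoc := by rintro ⟨X⟩ ⟨Y⟩ ⟨Z⟩; exact Quotient.sound (Biset.sum_assoc X Y Z)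
  add_comm := by rintro ⟨X⟩ ⟨Y⟩; exact Quotient.sound (Biset.sum_comm X Y)
  zero_add := by rintro ⟨X⟩; exact Quotient.sound (Biset.empty_sum X)
  add_zero := by
    rintro ⟨X⟩
    exact Quotient.sound ((Biset.sum_comm X _).trans (Biset.empty_sum X))
  mul_assoc := by rintro ⟨X⟩ ⟨Y⟩ ⟨Z⟩; exact Quotient.sound (Biset.tensor_assoc X Y Z)
  one_mul := by rintro ⟨X⟩; exact Quotient.sound (Biset.regular_tensor X)
  mul_one := by rintro ⟨X⟩; exact Quotient.sound (Biset.tensor_regular X)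
  left_distrib := by rintro ⟨X⟩ ⟨Y⟩ ⟨Z⟩; exact Quotient.sound (Biset.tensor_sum X Y Z)
  right_distrib := by rintro ⟨X⟩ ⟨Y⟩ ⟨Z⟩; exact Quotient.sound (Biset.sum_tensor X Y Z)
  zero_mul := by rintro ⟨X⟩; exact Quotient.sound (Biset.empty_tensor X)
  mul_zero := by rintro ⟨X⟩; exact Quotient.sound (Biset.tensor_empty X)

theorem BisetClass.mk_eq_iff {G : Type} [Group G] (X Y : Biset G G) :
    BisetClass.mk X = BisetClass.mk Y ↔ Biset.Iso X Y :=
  Quotient.eq (r := Biset.isoSetoid G G)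

theorem BisetClass.mk_add {G : Type} [Group G] [Finite G] (X Y : Biset G G) :
    BisetClass.mk X + BisetClass.mk Y = BisetClass.mk (Biset.sum X Y) := rfl

theorem BisetClass.mk_mul {G : Type} [Group G] [Finite G] (X Y : Biset G G) :
    BisetClass.mk X * BisetClass.mk Y = BisetClass.mk (Biset.tensor X Y) := rfl

/-- The double Burnside ring `B(G, G)`: the Grothendieck group of the monoid of isomorphism
classes of finite `(G, G)`-bisets under disjoint union. -/
def DoubleBurnside (G : Type) [Group G] [Finite G] : Type 1 :=
  Algebra.GrothendieckAddGroup (BisetClass G)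

namespace DoubleBurnside

variable (G : Type) [Group G] [Finite G]

instance instAddCommGroup : AddCommGroup (DoubleBurnside G) :=
  inferInstanceAs (AddCommGroup (Algebra.GrothendieckAddGroup (BisetClass G)))

/-- The canonical map from isomorphism classes of bisets to the double Burnside ring. -/
def of : BisetClass G →+ DoubleBurnside G :=
  (Algebra.GrothendieckAddGroup.of : BisetClass G →+ Algebra.GrothendieckAddGroup (BisetClass G))

variable {G}

/-- Additive maps out of the semiring of classes extend to the double Burnside ring. -/
noncomputable def lift {A : Type 1} [AddCommGroup A] (f : BisetClass G →+ A) :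
    DoubleBurnside G →+ A :=
  (Algebra.GrothendieckAddGroup.lift f : Algebra.GrothendieckAddGroup (BisetClass G) →+ A)

theorem lift_of {A : Type 1} [AddCommGroup A] (f : BisetClass G →+ A) (s : BisetClass G) :
    lift f (of G s) = f s :=
  DFunLike.congr_fun (Algebra.GrothendieckAddGroup.lift.symm_apply_apply f) s

theorem hom_ext {A : Type 1} [AddCommGroup A] {f g : DoubleBurnside G →+ A}
    (h : ∀ s, f (of G s) = g (of G s)) : f = g :=
  (Algebra.GrothendieckAddGroup.lift (M := BisetClass G) (G := A)).symm.injective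
    (AddMonoidHom.ext h)

/-- The biadditive extension of the tensor product of bisets. -/
noncomputable def mulHom : DoubleBurnside G →+ DoubleBurnside G →+ DoubleBurnside G :=
  lift
    { toFun := fun s => lift ((of G).comp (AddMonoidHom.mulLeft s))
      map_zero' := hom_ext fun t => by simp [lift_of]
      map_add' := fun s s' => hom_ext fun t => by simp [lift_of, add_mul] }

theorem mulHom_of (s t : BisetClass G) : mulHom (of G s) (of G t) = of G (s * t) := by
  simp [mulHom, lift_of]

theorem induction {p : DoubleBurnside G → Prop} (a : DoubleBurnside G)
    (h : ∀ s t, p (of G s - of G t)) : p a := by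
  have key : ∀ a : DoubleBurnside G, ∃ s t, a = of G s - of G t := by
    let S : AddSubgroup (DoubleBurnside G) :=
      { carrier := {a | ∃ s t, a = of G s - of G t}
        zero_mem' := ⟨0, 0, by simp⟩
        add_mem' := by
          rintro _ _ ⟨s, t, rfl⟩ ⟨s', t', rfl⟩
          exact ⟨s + s', t + t', by simp only [map_add]; abel⟩
        neg_mem' := by
          rintro _ ⟨s, t, rfl⟩
          exact ⟨t, s, by abel⟩ }
    have hS : QuotientAddGroup.mk' S = 0 := hom_ext fun s => by
      have : of G s ∈ S := ⟨s, 0, by simp⟩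
      simpa using this
    intro a
    have h0 := DFunLike.congr_fun hS a
    have h1 : a ∈ S := by simpa using h0
    exact h1
  obtain ⟨s, t, rfl⟩ := key a
  exact h s t

/-- The double Burnside ring; the product is induced by the tensor product of bisets. -/
noncomputable instance instRing : Ring (DoubleBurnside G) where
  __ := instAddCommGroup G
  mul a b := mulHom a b
  one := of G 1
  npow := @npowRec _ ⟨of G 1⟩ ⟨fun a b => mulHom a b⟩
  zero_mul a := by change mulHom 0 a = 0; simp
  mul_zero a := by change mulHom a 0 = 0; simp
  left_distrib a b c := by change mulHom a (b + c) = mulHom a b + mulHom a c; simp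
  right_distrib a b c := by change mulHom (a + b) c = mulHom a c + mulHom b c; simp
  one_mul a := by
    change mulHom (of G 1) a = a
    induction a using induction with | h s t => simp [mulHom_of]
  mul_one a := by
    change mulHom a (of G 1) = a
    induction a using induction with | h s t => simp [mulHom_of]
  mul_assoc a b c := by
    change mulHom (mulHom a b) c = mulHom a (mulHom b c)
    induction a using induction with | h s t =>
    induction b using induction with | h s' t' =>
    induction c using induction with | h s'' t'' => simp [mulHom_of, mul_assoc]

theorem of_mul (s t : BisetClass G) : of G (s * t) = of G s * of G t :=
  (mulHom_of s t).symm

end DoubleBurnside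

/-- The rational double Burnside algebra `ℚ B(G, G) = ℚ ⊗ B(G, G)`. -/
abbrev RatDoubleBurnside (G : Type) [Group G] [Finite G] : Type 1 :=
  TensorProduct ℤ ℚ (DoubleBurnside G)

/-- The element `[X] = 1 ⊗ [X]` of `ℚ B(G, G)` given by a finite `(G, G)`-biset `X`. -/
noncomputable def bisetElement {G : Type} [Group G] [Finite G] (X : Biset G G) :
    RatDoubleBurnside G :=
  TensorProduct.tmul ℤ (1 : ℚ) (DoubleBurnside.of G (BisetClass.mk X))

theorem bisetElement_mul {G : Type} [Group G] [Finite G] (X Y : Biset G G) :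
    bisetElement X * bisetElement Y = bisetElement (Biset.tensor X Y) := by
  simp only [bisetElement, Algebra.TensorProduct.tmul_mul_tmul, mul_one,
    ← DoubleBurnside.of_mul, BisetClass.mk_mul]

theorem bisetElement_add {G : Type} [Group G] [Finite G] (X Y : Biset G G) :
    bisetElement X + bisetElement Y = bisetElement (Biset.sum X Y) := by
  simp only [bisetElement, ← TensorProduct.tmul_add, ← map_add, BisetClass.mk_add]

/-! ### Goursat sections and the labelling of the classes of subgroups of `S₃ × S₃` -/

/-- The subgroup `L` of `G × H` has Goursat sections conjugate to `S` in `G` and to `T` in `H`.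
Here a section `(P, K)` is given by its top group `P` and its bottom group `K`; the Goursat
sections of `L` are `(p₁(L), k₁(L))` and `(p₂(L), k₂(L))`, where `pᵢ` are the projections of `L`
and `k₁(L) = {g | (g, 1) ∈ L}`, `k₂(L) = {h | (1, h) ∈ L}`. -/
def HasGoursatSections {G H : Type} [Group G] [Group H] (L : Subgroup (G × H))
    (S : Subgroup G × Subgroup G) (T : Subgroup H × Subgroup H) : Prop :=
  (∃ g : G, (L.map (MonoidHom.fst G H)).map (MulAut.conj g).toMonoidHom = S.1 ∧
    L.goursatFst.map (MulAut.conj g).toMonoidHom = S.2) ∧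
  (∃ h : H, (L.map (MonoidHom.snd G H)).map (MulAut.conj h).toMonoidHom = T.1 ∧
    L.goursatSnd.map (MulAut.conj h).toMonoidHom = T.2)

/-- The symmetric group of degree three. -/
abbrev S3 : Type := Equiv.Perm (Fin 3)

/-- A subgroup of order two of `S₃`. -/
def C2 : Subgroup S3 := Subgroup.zpowers (Equiv.swap 0 1)

/-- The subgroup of order three of `S₃`. -/
def C3 : Subgroup S3 := alternatingGroup (Fin 3)

/-- Representatives `(P, K)` of the eight conjugacy classes of sections of `S₃`:
`(1,1), (2,2), (3,3), (G,G), (2,1), (G,3), (3,1), (G,1)`. -/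
def sectionRep : Fin 8 → Subgroup S3 × Subgroup S3 :=
  ![(⊥, ⊥), (C2, C2), (C3, C3), (⊤, ⊤), (C2, ⊥), (⊤, C3), (C3, ⊥), (⊤, ⊥)]

/-- The labels (first section, second section) of the conjugacy classes of subgroups
`L₁, …, L₂₂` of `S₃ × S₃`; indices here and below start at `0`. -/
def sectionLabel : Fin 22 → Fin 8 × Fin 8 :=
  ![(0, 0), (0, 1), (0, 2), (0, 3),
    (1, 0), (1, 1), (1, 2), (1, 3),
    (2, 0), (2, 1), (2, 2), (2, 3),
    (3, 0), (3, 1), (3, 2), (3, 3),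
    (4, 4), (4, 5),
    (5, 4), (5, 5),
    (6, 6),
    (7, 7)]

/-! ### The modified table of marks and the ghost matrices -/

/-- The modified table of marks `M'` of `S₃ × S₃`. -/
def modifiedMarks : Matrix (Fin 22) (Fin 22) ℚ :=
  !![6, 0, 0, 0, 0, 0, 0, 0, 0, 0, 0, 0, 0, 0, 0, 0, 0, 0, 0, 0, 0, 0;
     3, 1, 0, 0, 0, 0, 0, 0, 0, 0, 0, 0, 0, 0, 0, 0, 0, 0, 0, 0, 0, 0;
     2, 0, 2, 0, 0, 0, 0, 0, 0, 0, 0, 0, 0, 0, 0, 0, 0, 0, 0, 0, 0, 0;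
     1, 1, 1, 1, 0, 0, 0, 0, 0, 0, 0, 0, 0, 0, 0, 0, 0, 0, 0, 0, 0, 0;
     3, 0, 0, 0, 3, 0, 0, 0, 0, 0, 0, 0, 0, 0, 0, 0, 0, 0, 0, 0, 0, 0;
     3/2, 1/2, 0, 0, 3/2, 1/2, 0, 0, 0, 0, 0, 0, 0, 0, 0, 0, 0, 0, 0, 0, 0, 0;
     1, 0, 1, 0, 1, 0, 1, 0, 0, 0, 0, 0, 0, 0, 0, 0, 0, 0, 0, 0, 0, 0;
     1/2, 1/2, 1/2, 1/2, 1/2, 1/2, 1/2, 1/2, 0, 0, 0, 0, 0, 0, 0, 0, 0, 0, 0, 0, 0, 0;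
     2, 0, 0, 0, 0, 0, 0, 0, 4, 0, 0, 0, 0, 0, 0, 0, 0, 0, 0, 0, 0, 0;
     1, 1/3, 0, 0, 0, 0, 0, 0, 2, 2/3, 0, 0, 0, 0, 0, 0, 0, 0, 0, 0, 0, 0;
     2/3, 0, 2/3, 0, 0, 0, 0, 0, 4/3, 0, 4/3, 0, 0, 0, 0, 0, 0, 0, 0, 0, 0, 0;
     1/3, 1/3, 1/3, 1/3, 0, 0, 0, 0, 2/3, 2/3, 2/3, 2/3, 0, 0, 0, 0, 0, 0, 0, 0, 0, 0;
     1, 0, 0, 0, 3, 0, 0, 0, 2, 0, 0, 0, 6, 0, 0, 0, 0, 0, 0, 0, 0, 0;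
     1/2, 1/6, 0, 0, 3/2, 1/2, 0, 0, 1, 1/3, 0, 0, 3, 1, 0, 0, 0, 0, 0, 0, 0, 0;
     1/3, 0, 1/3, 0, 1, 0, 1, 0, 2/3, 0, 2/3, 0, 2, 0, 2, 0, 0, 0, 0, 0, 0, 0;
     1/6, 1/6, 1/6, 1/6, 1/2, 1/2, 1/2, 1/2, 1/3, 1/3, 1/3, 1/3, 1, 1, 1, 1, 0, 0, 0, 0, 0, 0;
     3, 0, 0, 0, 0, 1, 0, 0, 0, 0, 0, 0, 0, 0, 0, 0, 1, 0, 0, 0, 0, 0;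
     1, 0, 1, 0, 0, 1, 0, 1, 0, 0, 0, 0, 0, 0, 0, 0, 1, 1, 0, 0, 0, 0;
     1, 0, 0, 0, 0, 1, 0, 0, 2, 0, 0, 0, 0, 2, 0, 0, 1, 0, 2, 0, 0, 0;
     1/3, 0, 1/3, 0, 0, 1, 0, 1, 2/3, 0, 2/3, 0, 0, 2, 0, 2, 1, 1, 2, 2, 0, 0;
     2, 0, 0, 0, 0, 0, 0, 0, 0, 0, 2, 0, 0, 0, 0, 0, 0, 0, 0, 0, 2, 0;
     1, 0, 0, 0, 0, 1, 0, 0, 0, 0, 1, 0, 0, 0, 0, 0, 1, 0, 0, 0, 1, 1]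

/-- The sparse `8 × 8` matrix with coordinates `x₁, …, x₂₂` (here `x 0, …, x 21`). -/
def ghostMatrix (x : Fin 22 → ℚ) : Matrix (Fin 8) (Fin 8) ℚ :=
  !![x 0, x 1, x 2, x 3, 0, 0, 0, 0;
     x 4, x 5, x 6, x 7, 0, 0, 0, 0;
     x 8, x 9, x 10, x 11, 0, 0, 0, 0;
     0, 0, 0, x 21, 0, 0, 0, 0;
     0, 0, 0, 0, x 16, x 17, 0, 0;
     0, 0, 0, 0, 0, x 21, 0, 0;
     0, 0, 0, 0, 0, 0, x 20, 0;
     x 12, x 13, x 14, x 15, x 18, x 19, 0, x 21]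

/-!
# The mark homomorphism of the rational double Burnside algebra of `S₃`

Regard a finite `(G, G)`-biset `X` as a `G × G`-set, with stabilizers
`S_x = {(g, h) | g · x = x · h}`, and attach to a function `φ` on the subgroups of `G × G` the
additive invariant `∑ₓ φ (S_x)` of `X` (`Biset.total`). The stabilizer of the point `[x, y]` of a
tensor product is the relational composite of `S_x` and `S_y` (`Biset.stab_tmk`), and the orbit of
`(x, y)` that is collapsed to this point has `|G| / κ` elements, where `κ` counts the `h` with
`(1, h) ∈ S_x` and `(h, 1) ∈ S_y` (`Biset.sum_tensor_eq`). Averaging over the conjugates of `S_y`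
gives a criterion for the invariant to be multiplicative which involves only pairs of subgroups
(`Biset.total_tensor`):
`∑ₕ κ (S, ʰT) φ (S ∘ ʰT) = |G|² φ (S) φ (T)`.

For `G = S₃` let `φ (S)` be `|S| / 36` times the ghost matrix of the row of `M'` that belongs to
the class of `S`. This function is constant on conjugacy classes, so the invariant takes `b_i` to
the ghost matrix of the `i`-th row of `M'` (`S3.coords_coset`). As the orders of the groups in the
Goursat sections of `S` determine its class, the criterion need only be checked for representatives
of the `22` classes, where it is a finite computation with subgroups encoded as bit masks
(`S3.map_maskSum_eq_ghostMul`).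

The classes of subgroups are found from Goursat's description: every subgroup has one of the `22`
labels (`S3.exists_label`), and two subgroups with the same label are conjugate
(`S3.exists_conjBy_eq_labelRep`), because the isomorphism between the two sections is unique up to
conjugation. Hence the `b_i` span, by decomposition into orbits (`RatDoubleBurnside.span_coset`).
Their coordinate vectors are the rows of the triangular matrix `M'`, which has nonzero diagonal
entries, so they form a basis, and the coordinates are an isomorphism onto `ℚ²²` whose inverse
images of the standard basis are the `c_j`.
-/

/-! ### Stabilizers and composition of relations -/

namespace Subgroup

variable {G H K : Type} [Group G] [Group H] [Group K]

/-- The conjugate `p S p⁻¹` of a subgroup. -/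
def conjBy (p : G) (S : Subgroup G) : Subgroup G := S.map (MulAut.conj p).toMonoidHom

theorem mem_conjBy {p q : G} {S : Subgroup G} : q ∈ S.conjBy p ↔ p⁻¹ * q * p ∈ S := by
  rw [conjBy, Subgroup.mem_map_equiv]; simp

theorem conjBy_mul (p q : G) (S : Subgroup G) : S.conjBy (p * q) = (S.conjBy q).conjBy p := by
  ext x; simp only [mem_conjBy, mul_inv_rev, mul_assoc]

theorem conjBy_one (S : Subgroup G) : S.conjBy 1 = S := by
  ext x; simp [mem_conjBy]

theorem card_conjBy (p : G) (S : Subgroup G) : Nat.card (S.conjBy p) = Nat.card S :=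
  Subgroup.card_map_of_injective (MulAut.conj p).injective

/-- The composite of two subgroups regarded as relations from `G` to `H` and from `H` to `K`. -/
def relComp (S : Subgroup (G × H)) (T : Subgroup (H × K)) : Subgroup (G × K) where
  carrier := {p | ∃ h, (p.1, h) ∈ S ∧ (h, p.2) ∈ T}
  one_mem' := ⟨1, S.one_mem, T.one_mem⟩
  mul_mem' := by
    rintro p q ⟨h, h1, h2⟩ ⟨k, k1, k2⟩
    exact ⟨h * k, S.mul_mem h1 k1, T.mul_mem h2 k2⟩
  inv_mem' := by
    rintro p ⟨h, h1, h2⟩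
    exact ⟨h⁻¹, S.inv_mem h1, T.inv_mem h2⟩

theorem mem_relComp {S : Subgroup (G × H)} {T : Subgroup (H × K)} {p : G × K} :
    p ∈ S.relComp T ↔ ∃ h, (p.1, h) ∈ S ∧ (h, p.2) ∈ T := Iff.rfl

/-- The number of `h` that relate `1` to `1` in the composite of `S` and `T`, that is, the order of
the intersection of `{h | (1, h) ∈ S}` and `{h | (h, 1) ∈ T}`. -/
noncomputable def overlap (S : Subgroup (G × H)) (T : Subgroup (H × K)) : ℕ :=
  Nat.card {h : H // (1, h) ∈ S ∧ (h, 1) ∈ T}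

theorem relComp_conjBy (S : Subgroup (G × H)) (T : Subgroup (H × K)) (g : G) (h : H) (k : K) :
    (S.conjBy (g, h)).relComp (T.conjBy (h, k)) = (S.relComp T).conjBy (g, k) := by
  ext ⟨a, b⟩
  simp only [mem_relComp, mem_conjBy, Prod.inv_mk, Prod.mk_mul_mk]
  exact ⟨fun ⟨x, hx⟩ => ⟨_, hx⟩, fun ⟨x, hx⟩ => ⟨h * x * h⁻¹, by simpa [mul_assoc] using hx⟩⟩

theorem overlap_conjBy (S : Subgroup (G × H)) (T : Subgroup (H × K)) (g : G) (h : H) (k : K) :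
    (S.conjBy (g, h)).overlap (T.conjBy (h, k)) = S.overlap T := by
  refine Nat.card_congr ((MulAut.conj h⁻¹).toEquiv.subtypeEquiv fun x => ?_)
  simp [mem_conjBy]

end Subgroup

namespace Biset

variable {G H K : Type} [Group G] [Group H] [Group K]

/-- The stabilizer of a point of a `(G, H)`-biset: the pairs `(g, h)` with `g · x = x · h`. -/
def stab (X : Biset G H) (x : X.carrier) : Subgroup (G × H) where
  carrier := {p | p.1 • x = X.act x p.2}
  one_mem' := by simp [act_one]
  mul_mem' := by
    rintro p q hp hq
    simp only [Set.mem_ofPred_eq, Prod.fst_mul, Prod.snd_mul, mul_smul, act_mul] at *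
    rw [hq, smul_act, hp]
  inv_mem' := by
    rintro p hp
    simp only [Set.mem_ofPred_eq, Prod.fst_inv, Prod.snd_inv] at *
    rw [inv_smul_eq_iff, smul_act, hp, ← act_mul, mul_inv_cancel, act_one]

theorem mem_stab {X : Biset G H} {x : X.carrier} {p : G × H} :
    p ∈ X.stab x ↔ p.1 • x = X.act x p.2 := Iff.rfl

theorem act_inv_eq_iff (X : Biset G H) (x y : X.carrier) (h : H) :
    X.act x h⁻¹ = y ↔ x = X.act y h := by
  constructor
  · rintro rfl; simp [← act_mul, act_one]
  · rintro rfl; simp [← act_mul, act_one]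

/-- The action `(g, h) · x = g · x · h⁻¹` of `G × H` on a `(G, H)`-biset. -/
def move (X : Biset G H) (p : G × H) (x : X.carrier) : X.carrier := p.1 • X.act x p.2⁻¹

theorem move_one (X : Biset G H) (x : X.carrier) : X.move 1 x = x := by
  simp [move, act_one]

theorem move_mul (X : Biset G H) (p q : G × H) (x : X.carrier) :
    X.move (p * q) x = X.move p (X.move q x) := by
  simp only [move, Prod.fst_mul, Prod.snd_mul, mul_smul, mul_inv_rev, act_mul, smul_act]

theorem mem_stab_iff_move {X : Biset G H} {x : X.carrier} {p : G × H} :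
    p ∈ X.stab x ↔ X.move p x = x := by
  rw [mem_stab, move, smul_act, act_inv_eq_iff]

theorem move_eq_move_iff (X : Biset G H) (p q : G × H) (x : X.carrier) :
    X.move p x = X.move q x ↔ p⁻¹ * q ∈ X.stab x := by
  rw [mem_stab_iff_move, move_mul]
  constructor
  · intro h; rw [← h, ← move_mul, inv_mul_cancel, move_one]
  · intro h
    have := congrArg (X.move p) h
    rwa [← move_mul, mul_inv_cancel, move_one, eq_comm] at this

theorem stab_move (X : Biset G H) (x : X.carrier) (p : G × H) :
    X.stab (X.move p x) = (X.stab x).conjBy p := by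
  ext q
  rw [mem_stab_iff_move, Subgroup.mem_conjBy, ← move_mul, eq_comm, move_eq_move_iff, mul_assoc]

theorem Iso.stab_eq {X Y : Biset G H} (e : X.carrier ≃ Y.carrier)
    (h1 : ∀ (g : G) (x : X.carrier), e (g • x) = g • e x)
    (h2 : ∀ (x : X.carrier) (h : H), e (X.act x h) = Y.act (e x) h) (x : X.carrier) :
    Y.stab (e x) = X.stab x := by
  ext p
  rw [mem_stab, mem_stab, ← h1, ← h2, e.apply_eq_iff_eq]

/-- The stabilizer of a point of a tensor product is the composite of the stabilizers. -/
theorem stab_tmk (X : Biset G H) (Y : Biset H K) (x : X.carrier) (y : Y.carrier) :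
    (tensor X Y).stab (tmk X Y x y) = (X.stab x).relComp (Y.stab y) := by
  ext ⟨g, k⟩
  rw [mem_stab, Subgroup.mem_relComp]
  change tmk X Y (g • x) y = tmk X Y x (Y.act y k) ↔ _
  refine (Quotient.eq (r := tensorSetoid X Y)).trans ?_
  change (∃ h : H, (x, Y.act y k) = (X.act (g • x) h, h⁻¹ • y)) ↔ _
  simp only [mem_stab, Prod.mk.injEq]
  constructor
  · rintro ⟨h, h1, h2⟩
    exact ⟨h⁻¹, ((act_inv_eq_iff X _ _ _).2 h1).symm, h2.symm⟩
  · rintro ⟨h, h1, h2⟩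
    exact ⟨h⁻¹, ((act_inv_eq_iff X _ _ _).2 h1).symm, by simpa using h2.symm⟩

/-! ### Sums over a tensor product -/

/-- Orbit counting for the action of `H` on `X × Y` whose orbits are the points of the tensor
product: an orbit through a point with stabilizer of order `k` has `|H| / k` points. -/
theorem sum_tensor_eq [Fintype H] (X : Biset G H) (Y : Biset H K) [Fintype X.carrier]
    [Fintype Y.carrier] [Fintype (tensor X Y).carrier] {A : Type*} [AddCommMonoid A]
    (F : (tensor X Y).carrier → A) :
    ∑ p : X.carrier × Y.carrier, (X.stab p.1).overlap (Y.stab p.2) • F (tmk X Y p.1 p.2) =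
      Fintype.card H • ∑ z, F z := by
  classical
  rw [← Finset.sum_fiberwise (s := Finset.univ)
    (g := fun p : X.carrier × Y.carrier => tmk X Y p.1 p.2), Finset.smul_sum]
  refine Finset.sum_congr rfl fun z _ => ?_
  obtain ⟨p₀, rfl⟩ : ∃ p₀ : X.carrier × Y.carrier, tmk X Y p₀.1 p₀.2 = z :=
    tensor_ind (p := fun z => ∃ p₀ : X.carrier × Y.carrier, tmk X Y p₀.1 p₀.2 = z)
      (fun x y => ⟨(x, y), rfl⟩) z
  rw [Finset.sum_congr rfl (g := fun p : X.carrier × Y.carrier =>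
    (X.stab p.1).overlap (Y.stab p.2) • F (tmk X Y p₀.1 p₀.2))
    (fun p hp => by rw [(Finset.mem_filter.1 hp).2]), ← Finset.sum_smul]
  congr 1
  let m : X.carrier × Y.carrier → H → X.carrier × Y.carrier :=
    fun p h => (X.act p.1 h, h⁻¹ • p.2)
  rw [← Finset.card_univ, Finset.card_eq_sum_card_fiberwise (f := m p₀)
    (t := Finset.univ.filter fun p => tmk X Y p.1 p.2 = tmk X Y p₀.1 p₀.2)]
  · refine Finset.sum_congr rfl fun p hp => ?_
    obtain ⟨k, rfl⟩ : ∃ k, p = m p₀ k :=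
      (Quotient.eq (r := tensorSetoid X Y)).1 (Finset.mem_filter.1 hp).2.symm
    rw [Subgroup.overlap, Nat.card_eq_fintype_card, ← Fintype.card_subtype]
    refine Fintype.card_congr ((Equiv.mulLeft k).subtypeEquiv fun h => ?_)
    simp only [mem_stab, m, one_smul, act_one, Equiv.coe_mulLeft, Prod.mk.injEq, act_mul,
      mul_inv_rev, mul_smul, inv_smul_eq_iff]
    exact and_congr eq_comm (by rw [eq_comm, smul_eq_iff_eq_inv_smul, inv_inv])
  · intro h _
    simp [m, tmk_act]

/-- The sum over the points of a biset of a function of their stabilizers. -/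
noncomputable def total {A : Type*} [AddCommMonoid A] (φ : Subgroup (G × H) → A)
    (X : Biset G H) : A := ∑ᶠ x, φ (X.stab x)

section total

variable {A : Type*} [AddCommMonoid A] (φ : Subgroup (G × H) → A)

theorem total_eq_of_iso {X Y : Biset G H} : Iso X Y → total φ X = total φ Y := by
  rintro ⟨e, h1, h2⟩
  rw [total, total, ← finsum_comp_equiv e]
  simp only [Iso.stab_eq e h1 h2]

theorem total_sum (X Y : Biset G H) : total φ (sum X Y) = total φ X + total φ Y := by
  classical
  have := Fintype.ofFinite X.carrier
  have := Fintype.ofFinite Y.carrier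
  let : Fintype (sum X Y).carrier := inferInstanceAs (Fintype (X.carrier ⊕ Y.carrier))
  have hl : ∀ x, (sum X Y).stab (Sum.inl x) = X.stab x := fun x => by
    ext p; exact Sum.inl_injective.eq_iff (a := p.1 • x) (b := X.act x p.2)
  have hr : ∀ y, (sum X Y).stab (Sum.inr y) = Y.stab y := fun y => by
    ext p; exact Sum.inr_injective.eq_iff (a := p.1 • y) (b := Y.act y p.2)
  rw [total, total, total, finsum_eq_sum_of_fintype, finsum_eq_sum_of_fintype,
    finsum_eq_sum_of_fintype]
  refine (Fintype.sum_sum_type _).trans ?_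
  simp only [hl, hr]

theorem total_empty : total φ (empty G H) = 0 :=
  finsum_of_isEmpty (α := Empty) _

end total

/-- If `φ (S) φ (T)` is the average over `h ∈ H` of the values of `φ` at the composites of `S` with
`(h, 1) T (h, 1)⁻¹`, weighted by `overlap / |H|`, then `total φ` turns tensor products into
products. -/
theorem total_tensor [Fintype H] {A : Type*} [Ring A] [Algebra ℚ A] (φ : Subgroup (H × H) → A)
    (hφ : ∀ S T : Subgroup (H × H),
      ∑ h : H, S.overlap (T.conjBy (h, 1)) • φ (S.relComp (T.conjBy (h, 1))) =
        (Fintype.card H ^ 2 : ℕ) • (φ S * φ T)) (X Y : Biset H H) :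
    total φ (tensor X Y) = total φ X * total φ Y := by
  classical
  have := Fintype.ofFinite X.carrier
  have := Fintype.ofFinite Y.carrier
  have := Fintype.ofFinite (tensor X Y).carrier
  simp only [total, finsum_eq_sum_of_fintype]
  have key := sum_tensor_eq X Y fun z => φ ((tensor X Y).stab z)
  simp only [stab_tmk] at key
  let f : Subgroup (H × H) → Subgroup (H × H) → A := fun S T => S.overlap T • φ (S.relComp T)
  -- Replacing `y` by `h · y` does not change the sum over `X × Y`, so one may average over `h`.
  have avg (h : H) : ∑ p : X.carrier × Y.carrier, f (X.stab p.1) ((Y.stab p.2).conjBy (h, 1)) =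
      ∑ p : X.carrier × Y.carrier, f (X.stab p.1) (Y.stab p.2) := by
    refine Fintype.sum_equiv ((Equiv.refl _).prodCongr (MulAction.toPerm h)) _ _ fun p => ?_
    have := stab_move Y p.2 (h, 1)
    rw [move, inv_one, act_one] at this
    simp [this]
  have h2 : (Fintype.card H ^ 2 : ℕ) • ((∑ x, φ (X.stab x)) * ∑ y, φ (Y.stab y)) =
      (Fintype.card H ^ 2 : ℕ) • ∑ z, φ ((tensor X Y).stab z) := by
    rw [Finset.sum_mul_sum, ← Finset.sum_product', Finset.univ_product_univ, Finset.smul_sum]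
    simp only [← hφ]
    rw [Finset.sum_comm]
    refine (Finset.sum_congr rfl fun h _ => avg h).trans ?_
    rw [Finset.sum_const, Finset.card_univ, sq, mul_smul, ← key]
  have h3 : ((Fintype.card H ^ 2 : ℕ) : ℚ) ≠ 0 := by positivity
  have h4 := congrArg (((Fintype.card H ^ 2 : ℕ) : ℚ)⁻¹ • ·) h2
  simp only [← Nat.cast_smul_eq_nsmul ℚ, inv_smul_smul₀ h3] at h4
  exact h4.symm

/-! ### Transitive bisets and orbit decomposition -/

theorem move_coset [Finite G] [Finite H] (L : Subgroup (G × H)) (p q : G × H) :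
    (coset L).move p (QuotientGroup.mk q : (G × H) ⧸ L) =
      (QuotientGroup.mk (p * q) : (G × H) ⧸ L) := by
  change (QuotientGroup.mk ((p.1, 1) * ((1, p.2⁻¹⁻¹) * q)) : (G × H) ⧸ L) = _
  rw [← mul_assoc]; simp

theorem stab_coset [Finite G] [Finite H] (L : Subgroup (G × H)) (p : G × H) :
    (coset L).stab (QuotientGroup.mk p : (G × H) ⧸ L) = L.conjBy p := by
  ext q
  refine mem_stab_iff_move.trans ?_
  rw [move_coset, Subgroup.mem_conjBy, mul_assoc]
  exact eq_comm.trans QuotientGroup.eq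

/-- A conjugation-invariant function is constant on the stabilizers of a transitive biset. -/
theorem total_coset [Finite G] [Finite H] {A : Type*} [AddCommMonoid A]
    (φ : Subgroup (G × H) → A) (hφ : ∀ p S, φ (S.conjBy p) = φ S) (L : Subgroup (G × H)) :
    total φ (coset L) = L.index • φ L := by
  have : Fintype (coset L).carrier := Fintype.ofFinite _
  rw [total, finsum_eq_sum_of_fintype, Finset.sum_congr rfl (g := fun _ => φ L), Finset.sum_const,
    Finset.card_univ, ← Nat.card_eq_fintype_card]
  · rfl
  · rintro z -
    obtain ⟨p, rfl⟩ := QuotientGroup.mk_surjective (s := L) z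
    rw [stab_coset, hφ]

/-- Orbit-stabilizer theorem for bisets. -/
theorem coset_stab_iso [Finite G] [Finite H] (X : Biset G H) (x : X.carrier)
    (hx : ∀ y, ∃ p, X.move p x = y) : Iso (coset (X.stab x)) X := by
  have key : ∀ p q : G × H, (QuotientGroup.mk p : (G × H) ⧸ X.stab x) = QuotientGroup.mk q ↔
      X.move p x = X.move q x := fun p q => by
    rw [QuotientGroup.eq, move_eq_move_iff]
  let f : (G × H) ⧸ X.stab x → X.carrier :=
    Quotient.lift (fun p => X.move p x) fun p q h => (key p q).1 (Quotient.sound h)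
  have hf : Function.Bijective f := by
    constructor
    · intro y z
      obtain ⟨p, rfl⟩ := QuotientGroup.mk_surjective y
      obtain ⟨q, rfl⟩ := QuotientGroup.mk_surjective z
      exact (key p q).2
    · intro y
      obtain ⟨p, rfl⟩ := hx y
      exact ⟨QuotientGroup.mk p, rfl⟩
  refine ⟨Equiv.ofBijective f hf, fun g z => ?_, fun z h => ?_⟩
  · obtain ⟨p, rfl⟩ := QuotientGroup.mk_surjective (s := X.stab x) z
    change (g * p.1) • X.act x (1 * p.2)⁻¹ = g • p.1 • X.act x p.2⁻¹
    rw [one_mul, mul_smul]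
  · obtain ⟨p, rfl⟩ := QuotientGroup.mk_surjective (s := X.stab x) z
    change (1 * p.1) • X.act x (h⁻¹ * p.2)⁻¹ = X.act (p.1 • X.act x p.2⁻¹) h
    rw [one_mul, ← smul_act, ← act_mul, mul_inv_rev, inv_inv]

theorem coset_conjBy_iso [Finite G] [Finite H] (L : Subgroup (G × H)) (p : G × H) :
    Iso (coset (L.conjBy p)) (coset L) := by
  rw [← stab_coset]
  refine coset_stab_iso _ _ fun y => ?_
  obtain ⟨q, rfl⟩ := QuotientGroup.mk_surjective (s := L) y
  exact ⟨q * p⁻¹, (move_coset L _ p).trans (by rw [inv_mul_cancel_right])⟩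

/-- The restriction of a biset to a subset stable under both actions. -/
def restrict (X : Biset G H) (s : Set X.carrier) (hl : ∀ (g : G), ∀ x ∈ s, g • x ∈ s)
    (hr : ∀ (h : H), ∀ x ∈ s, X.act x h ∈ s) : Biset G H where
  carrier := s
  left :=
    { smul := fun g x => ⟨g • x.1, hl g x.1 x.2⟩
      one_smul := fun x => Subtype.ext (one_smul G x.1)
      mul_smul := fun g h x => Subtype.ext (mul_smul g h x.1) }
  right :=
    { smul := fun h x => ⟨X.act x.1 h.unop, hr h.unop x.1 x.2⟩
      one_smul := fun x => Subtype.ext (X.act_one x.1)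
      mul_smul := fun g h x => Subtype.ext (X.act_mul x.1 h.unop g.unop) }
  comm := @SMulCommClass.mk _ _ _ (_) (_) fun g h x => Subtype.ext (X.smul_act g x.1 h.unop)

theorem stab_restrict (X : Biset G H) (s : Set X.carrier) (hl hr) (x : s) :
    (X.restrict s hl hr).stab x = X.stab x.1 := by
  ext p
  exact Subtype.ext_iff

/-- A nonempty finite biset is the disjoint union of the orbit of a point and its complement. -/
theorem exists_iso_sum_coset [Finite G] [Finite H] (X : Biset G H) (x : X.carrier) :
    ∃ Y : Biset G H, Nat.card Y.carrier < Nat.card X.carrier ∧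
      Iso X (sum (coset (X.stab x)) Y) := by
  classical
  let s : Set X.carrier := {y | ∃ p, X.move p x = y}
  have hl : ∀ (g : G), ∀ y ∈ s, g • y ∈ s := by
    rintro g _ ⟨p, rfl⟩
    exact ⟨(g, 1) * p, by rw [move_mul, move, inv_one, act_one]⟩
  have hr : ∀ (h : H), ∀ y ∈ s, X.act y h ∈ s := by
    rintro h _ ⟨p, rfl⟩
    exact ⟨(1, h⁻¹) * p, by rw [move_mul, move, one_smul, inv_inv]⟩
  have hl' : ∀ (g : G), ∀ y ∈ sᶜ, g • y ∈ sᶜ := fun g y hy h => hy (by simpa using hl g⁻¹ _ h)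
  have hr' : ∀ (h : H), ∀ y ∈ sᶜ, X.act y h ∈ sᶜ := fun h y hy k =>
    hy (by simpa [← act_mul, act_one] using hr h⁻¹ _ k)
  have hx : x ∈ s := ⟨1, X.move_one x⟩
  refine ⟨X.restrict sᶜ hl' hr', ?_, ?_⟩
  · exact Finite.card_subtype_lt (p := fun y => y ∈ sᶜ) (x := x) (fun h => h hx)
  · have h1 : Iso (coset (X.stab x)) (X.restrict s hl hr) := by
      rw [← stab_restrict X s hl hr ⟨x, hx⟩]
      refine coset_stab_iso _ _ ?_
      rintro ⟨_, p, rfl⟩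
      exact ⟨p, rfl⟩
    refine Iso.trans ?_ (sum_congr h1.symm (Iso.refl _))
    refine Iso.symm ⟨Equiv.Set.sumCompl s, ?_, ?_⟩
    · rintro g (y | y) <;> rfl
    · rintro (y | y) h <;> rfl

end Biset

/-! ### Linear maps out of the rational double Burnside algebra -/

namespace RatDoubleBurnside

variable {G : Type} [Group G] [Finite G]

theorem span_bisetElement :
    Submodule.span ℚ (Set.range (bisetElement (G := G))) = ⊤ := by
  refine eq_top_iff.2 fun a _ => ?_
  induction a using TensorProduct.induction_on with
  | zero => exact Submodule.zero_mem _
  | add a b ha hb => exact Submodule.add_mem _ (ha trivial) (hb trivial)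
  | tmul q a =>
    have h (X : BisetClass G) : (q ⊗ₜ[ℤ] DoubleBurnside.of G X : RatDoubleBurnside G) ∈
        Submodule.span ℚ (Set.range (bisetElement (G := G))) := by
      obtain ⟨X, rfl⟩ := Quotient.exists_rep X
      have := Submodule.smul_mem _ q
        (Submodule.subset_span (R := ℚ) (Set.mem_range_self (f := bisetElement (G := G)) X))
      rwa [bisetElement, TensorProduct.smul_tmul', smul_eq_mul, mul_one] at this
    induction a using DoubleBurnside.induction with | h s t =>
    rw [TensorProduct.tmul_sub]
    exact Submodule.sub_mem _ (h s) (h t)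

/-- Orbit by orbit, a biset is a sum of coset bisets `[G × G / R i]`, provided that every subgroup
of `G × G` is conjugate to one of the `R i`. -/
theorem span_coset {ι : Type*} (R : ι → Subgroup (G × G))
    (hR : ∀ S : Subgroup (G × G), ∃ i p, S = (R i).conjBy p) :
    Submodule.span ℚ (Set.range fun i => bisetElement (Biset.coset (R i))) = ⊤ := by
  rw [eq_top_iff, ← span_bisetElement, Submodule.span_le]
  rintro _ ⟨X, rfl⟩
  induction h : Nat.card X.carrier using Nat.strong_induction_on generalizing X with | _ n ih =>
  have mk_eq {Y Z : Biset G G} (h : Biset.Iso Y Z) : bisetElement Y = bisetElement Z := by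
    rw [bisetElement, bisetElement, (BisetClass.mk_eq_iff Y Z).2 h]
  rcases isEmpty_or_nonempty X.carrier with hX | ⟨⟨x⟩⟩
  · have h0 : bisetElement (Biset.empty G G) = 0 := by
      have : DoubleBurnside.of G (BisetClass.mk (Biset.empty G G)) = 0 :=
        map_zero (DoubleBurnside.of G)
      rw [bisetElement, this, TensorProduct.tmul_zero]
    rw [mk_eq (Biset.empty_iso hX (Y := Biset.empty G G) ⟨fun x => Empty.elim x⟩), h0]
    exact Submodule.zero_mem _
  · obtain ⟨Y, hY, hXY⟩ := X.exists_iso_sum_coset x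
    rw [mk_eq hXY, ← bisetElement_add]
    obtain ⟨i, p, hp⟩ := hR (X.stab x)
    rw [hp, mk_eq (Biset.coset_conjBy_iso _ p)]
    exact Submodule.add_mem _ (Submodule.subset_span ⟨i, rfl⟩) (ih _ (h ▸ hY) Y rfl)

section extension

variable {A : Type*} [AddCommGroup A] [Module ℚ A]

/-- The additive map on isomorphism classes of bisets given by `∑ₓ φ (stab x)`. -/
noncomputable def totalHom (φ : Subgroup (G × G) → A) : BisetClass G →+ A where
  toFun := Quotient.lift (Biset.total φ) fun _ _ h => Biset.total_eq_of_iso φ h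
  map_zero' := Biset.total_empty φ
  map_add' := by rintro ⟨X⟩ ⟨Y⟩; exact Biset.total_sum φ X Y

/-- The linear map on `ℚ B(G, G)` that sends the class of `X` to `∑ₓ φ (stab x)`. -/
noncomputable def totalMap (φ : Subgroup (G × G) → A) : RatDoubleBurnside G →ₗ[ℚ] A :=
  LinearMap.liftBaseChange ℚ (AddMonoidHom.toIntLinearMap
    (Algebra.GrothendieckAddGroup.lift (totalHom φ) : DoubleBurnside G →+ A))

theorem totalMap_bisetElement (φ : Subgroup (G × G) → A) (X : Biset G G) :
    totalMap φ (bisetElement X) = Biset.total φ X := by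
  refine (LinearMap.liftBaseChange_tmul ..).trans ?_
  rw [one_smul]
  exact DFunLike.congr_fun
    (Algebra.GrothendieckAddGroup.lift.symm_apply_apply (totalHom φ)) (BisetClass.mk X)

end extension

theorem totalMap_mul {A : Type*} [Ring A] [Algebra ℚ A] (φ : Subgroup (G × G) → A)
    (hφ : ∀ X Y : Biset G G,
      Biset.total φ (Biset.tensor X Y) = Biset.total φ X * Biset.total φ Y)
    (a b : RatDoubleBurnside G) : totalMap φ (a * b) = totalMap φ a * totalMap φ b := by
  have ha : a ∈ Submodule.span ℚ (Set.range (bisetElement (G := G))) :=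
    span_bisetElement (G := G) ▸ Submodule.mem_top
  have hb : b ∈ Submodule.span ℚ (Set.range (bisetElement (G := G))) :=
    span_bisetElement (G := G) ▸ Submodule.mem_top
  induction ha, hb using Submodule.span_induction₂ with
  | mem_mem x y hx hy =>
    obtain ⟨X, rfl⟩ := hx
    obtain ⟨Y, rfl⟩ := hy
    simp only [bisetElement_mul, totalMap_bisetElement, hφ]
  | zero_left => simp
  | zero_right => simp
  | add_left x y z _ _ _ h1 h2 => simp only [add_mul, map_add, h1, h2]
  | add_right x y z _ _ _ h1 h2 => simp only [mul_add, map_add, h1, h2]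
  | smul_left r x y _ _ h => simp only [smul_mul_assoc, map_smul, h]
  | smul_right r x y _ _ h => simp only [mul_smul_comm, map_smul, h]

end RatDoubleBurnside

/-! ### Sections of the symmetric group of degree three -/

namespace S3

open Equiv Subgroup

/-- The transposition that generates `C2`. -/
def s : S3 := swap 0 1

/-- A three-cycle. -/
def r : S3 := finRotate 3

theorem mem_C2 {p : S3} : p ∈ C2 ↔ p = 1 ∨ p = s := by
  rw [C2, mem_zpowers_iff]
  constructor
  · rintro ⟨k, rfl⟩
    have h2 : (swap 0 1 : S3) ^ (2 : ℤ) = 1 := by decide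
    rcases Int.even_or_odd' k with ⟨n, rfl | rfl⟩
    · left; rw [zpow_mul, h2, one_zpow]
    · right; rw [zpow_add, zpow_mul, h2, one_zpow, one_mul, zpow_one, s]
  · rintro (rfl | rfl)
    · exact ⟨0, rfl⟩
    · exact ⟨1, rfl⟩

theorem mem_C3 {p : S3} : p ∈ C3 ↔ Perm.sign p = 1 := Perm.mem_alternatingGroup

theorem eq_of_sign_eq_one : ∀ p : S3, Perm.sign p = 1 → p = 1 ∨ p = r ∨ p = r⁻¹ := by decide

theorem exists_conj_eq_s : ∀ p : S3, Perm.sign p ≠ 1 → ∃ g : S3, p = g⁻¹ * s * g := by decide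

theorem sign_mul_eq_one : ∀ p q : S3, Perm.sign p ≠ 1 → Perm.sign q ≠ 1 →
    Perm.sign (p * q) = 1 := by decide

/-- A subgroup that contains a three-cycle contains all even permutations. -/
theorem mem_of_sign_eq_one {P : Subgroup S3} (hr : r ∈ P) {p : S3} (hp : Perm.sign p = 1) :
    p ∈ P := by
  rcases eq_of_sign_eq_one p hp with rfl | rfl | rfl
  exacts [P.one_mem, hr, P.inv_mem hr]

theorem eq_one_of_sign_eq_one {P : Subgroup S3} (hr : r ∉ P) {p : S3} (hp : p ∈ P)
    (h : Perm.sign p = 1) : p = 1 := by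
  rcases eq_of_sign_eq_one p h with rfl | rfl | rfl
  exacts [rfl, absurd hp hr, absurd (inv_mem_iff.1 hp) hr]

/-- The subgroups of the symmetric group of degree three, up to conjugation. -/
theorem subgroup_cases (P : Subgroup S3) :
    P = ⊥ ∨ (∃ g, P.conjBy g = C2) ∨ P = C3 ∨ P = ⊤ := by
  by_cases hr : r ∈ P <;> by_cases ho : ∃ t ∈ P, Perm.sign t ≠ 1
  · obtain ⟨t, ht, h1⟩ := ho
    refine Or.inr (Or.inr (Or.inr (eq_top_iff.2 fun q _ => ?_)))
    by_cases hq : Perm.sign q = 1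
    · exact mem_of_sign_eq_one hr hq
    · exact (P.mul_mem_cancel_right ht).1 (mem_of_sign_eq_one hr (sign_mul_eq_one q t hq h1))
  · push Not at ho
    refine Or.inr (Or.inr (Or.inl (le_antisymm (fun p hp => mem_C3.2 (ho p hp)) fun p hp => ?_)))
    exact mem_of_sign_eq_one hr (mem_C3.1 hp)
  · obtain ⟨t, ht, h1⟩ := ho
    obtain ⟨g, rfl⟩ := exists_conj_eq_s t h1
    refine Or.inr (Or.inl ⟨g, ?_⟩)
    ext x
    rw [mem_conjBy, mem_C2]
    constructor
    · intro hx
      by_cases hx1 : Perm.sign (g⁻¹ * x * g) = 1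
      · left
        have := eq_one_of_sign_eq_one hr hx hx1
        rwa [mul_assoc, inv_mul_eq_one, eq_comm, mul_eq_right] at this
      · right
        have := eq_one_of_sign_eq_one hr (P.mul_mem hx ht) (sign_mul_eq_one _ _ hx1 h1)
        have h2 : x * s = 1 := by
          rw [show g⁻¹ * x * g * (g⁻¹ * s * g) = g⁻¹ * (x * s * g) by group, inv_mul_eq_one,
            eq_comm, mul_eq_right] at this
          exact this
        rw [eq_inv_of_mul_eq_one_left h2]; decide
    · rintro (rfl | rfl)
      · simp
      · exact ht
  · push Not at ho
    exact Or.inl (P.eq_bot_iff_forall.2 fun p hp => eq_one_of_sign_eq_one hr hp (ho p hp))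

/-- The sections of the symmetric group of degree three, up to conjugation. -/
theorem section_cases (P K : Subgroup S3) (hKP : K ≤ P)
    (hn : ∀ p ∈ P, ∀ k ∈ K, p * k * p⁻¹ ∈ K) :
    ∃ (i : Fin 8) (g : S3), P.conjBy g = (sectionRep i).1 ∧ K.conjBy g = (sectionRep i).2 := by
  rcases subgroup_cases P with rfl | ⟨g, hP⟩ | rfl | rfl
  · exact ⟨0, 1, conjBy_one _, by rw [conjBy_one, le_bot_iff.1 hKP]; rfl⟩
  · have hK : K.conjBy g ≤ C2 := hP ▸ Subgroup.map_mono hKP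
    by_cases hs : s ∈ K.conjBy g
    · refine ⟨1, g, hP, le_antisymm hK fun x hx => ?_⟩
      rcases mem_C2.1 hx with rfl | rfl
      exacts [one_mem _, hs]
    · refine ⟨4, g, hP, (Subgroup.eq_bot_iff_forall _).2 fun x hx => ?_⟩
      rcases mem_C2.1 (hK hx) with rfl | rfl
      exacts [rfl, absurd hx hs]
  · by_cases hr : r ∈ K
    · refine ⟨2, 1, conjBy_one _, ?_⟩
      rw [conjBy_one]
      exact le_antisymm hKP fun p hp => mem_of_sign_eq_one hr (mem_C3.1 hp)
    · refine ⟨6, 1, conjBy_one _, ?_⟩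
      rw [conjBy_one]
      exact K.eq_bot_iff_forall.2 fun p hp => eq_one_of_sign_eq_one hr hp (mem_C3.1 (hKP hp))
  · rcases subgroup_cases K with rfl | ⟨g, hK⟩ | rfl | rfl
    · exact ⟨7, 1, conjBy_one _, conjBy_one _⟩
    · have h1 : s ∈ K.conjBy g := hK ▸ mem_C2.2 (Or.inr rfl)
      have h2 : r * s * r⁻¹ ∈ C2 := by
        rw [← hK, mem_conjBy]
        have := hn (g⁻¹ * r * g) trivial _ (mem_conjBy.1 h1)
        rwa [show g⁻¹ * r * g * (g⁻¹ * s * g) * (g⁻¹ * r * g)⁻¹ = g⁻¹ * (r * s * r⁻¹) * g by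
          group] at this
      rw [mem_C2] at h2
      exact absurd h2 (by decide)
    · exact ⟨5, 1, conjBy_one _, conjBy_one _⟩
    · exact ⟨3, 1, conjBy_one _, conjBy_one _⟩

end S3

/-! ### Goursat sections -/

namespace Subgroup

variable {G H : Type} [Group G] [Group H]

theorem mem_map_fst {L : Subgroup (G × H)} {g : G} :
    g ∈ L.map (MonoidHom.fst G H) ↔ ∃ h, (g, h) ∈ L := by
  simp [Subgroup.mem_map]

theorem mem_map_snd {L : Subgroup (G × H)} {h : H} :
    h ∈ L.map (MonoidHom.snd G H) ↔ ∃ g, (g, h) ∈ L := by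
  simp [Subgroup.mem_map]

theorem map_fst_conjBy (L : Subgroup (G × H)) (p : G × H) :
    (L.conjBy p).map (MonoidHom.fst G H) = (L.map (MonoidHom.fst G H)).conjBy p.1 := by
  rw [conjBy, conjBy, Subgroup.map_map, Subgroup.map_map]; rfl

theorem map_snd_conjBy (L : Subgroup (G × H)) (p : G × H) :
    (L.conjBy p).map (MonoidHom.snd G H) = (L.map (MonoidHom.snd G H)).conjBy p.2 := by
  rw [conjBy, conjBy, Subgroup.map_map, Subgroup.map_map]; rfl

theorem goursatFst_conjBy (L : Subgroup (G × H)) (p : G × H) :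
    (L.conjBy p).goursatFst = L.goursatFst.conjBy p.1 := by
  obtain ⟨a, b⟩ := p
  ext g; simp [mem_conjBy, mul_assoc]

theorem goursatSnd_conjBy (L : Subgroup (G × H)) (p : G × H) :
    (L.conjBy p).goursatSnd = L.goursatSnd.conjBy p.2 := by
  obtain ⟨a, b⟩ := p
  ext g; simp [mem_conjBy, mul_assoc]

/-- The order of `L` is that of the kernel times that of the image of the first projection. -/
theorem card_eq_fst (L : Subgroup (G × H)) :
    Nat.card L = Nat.card L.goursatSnd * Nat.card (L.map (MonoidHom.fst G H)) := by
  let f := (MonoidHom.fst G H).comp L.subtype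
  have h1 : Nat.card L.goursatSnd = Nat.card f.ker := by
    refine (Nat.card_congr (Equiv.ofBijective
      (fun x : f.ker => (⟨x.1.1.2, mem_goursatSnd.2 ?_⟩ : L.goursatSnd)) ⟨?_, ?_⟩)).symm
    · have h : x.1.1.1 = 1 := x.2
      rw [← h]; exact x.1.2
    · rintro ⟨⟨⟨a, b⟩, h⟩, h'⟩ ⟨⟨⟨c, d⟩, k⟩, k'⟩ hx
      obtain rfl : a = 1 := h'
      obtain rfl : c = 1 := k'
      obtain rfl : b = d := congrArg Subtype.val hx
      rfl
    · rintro ⟨h, hh⟩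
      exact ⟨⟨⟨(1, h), mem_goursatSnd.1 hh⟩, rfl⟩, rfl⟩
  have h2 : L.map (MonoidHom.fst G H) = f.range := by
    ext g; simp [f, MonoidHom.mem_range]
  rw [h1, h2, ← Subgroup.index_ker, Subgroup.card_mul_index]

theorem card_eq_snd (L : Subgroup (G × H)) :
    Nat.card L = Nat.card L.goursatFst * Nat.card (L.map (MonoidHom.snd G H)) := by
  have := card_eq_fst (L.map (MulEquiv.prodComm (M := G) (N := H)).toMonoidHom)
  rw [Subgroup.card_map_of_injective MulEquiv.prodComm.injective] at this
  have h1 : (L.map (MulEquiv.prodComm (M := G) (N := H)).toMonoidHom).goursatSnd =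
      L.goursatFst := by ext g; simp [Subgroup.mem_map]
  have h2 : (L.map (MulEquiv.prodComm (M := G) (N := H)).toMonoidHom).map (MonoidHom.fst H G) =
      L.map (MonoidHom.snd G H) := by rw [Subgroup.map_map]; rfl
  rwa [h1, h2] at this

end Subgroup

/-- The Goursat sections of a conjugate are conjugate. -/
theorem HasGoursatSections.conjBy {G H : Type} [Group G] [Group H] {L : Subgroup (G × H)}
    {S : Subgroup G × Subgroup G} {T : Subgroup H × Subgroup H} (h : HasGoursatSections L S T)
    (p : G × H) : HasGoursatSections (L.conjBy p) S T := by
  obtain ⟨⟨a, ha⟩, ⟨b, hb⟩⟩ := h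
  simp only [← Subgroup.conjBy.eq_1] at ha hb
  refine ⟨⟨a * p.1⁻¹, ?_⟩, ⟨b * p.2⁻¹, ?_⟩⟩
  · simpa only [← Subgroup.conjBy.eq_1, Subgroup.map_fst_conjBy, Subgroup.goursatFst_conjBy,
      ← Subgroup.conjBy_mul, inv_mul_cancel_right] using ha
  · simpa only [← Subgroup.conjBy.eq_1, Subgroup.map_snd_conjBy, Subgroup.goursatSnd_conjBy,
      ← Subgroup.conjBy_mul, inv_mul_cancel_right] using hb

namespace S3

open Equiv Subgroup

/-- The orders of the two groups of a section. -/
def sectionOrder : Fin 8 → ℕ × ℕ :=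
  ![(1, 1), (2, 2), (3, 3), (6, 6), (2, 1), (6, 3), (3, 1), (6, 1)]

theorem card_sectionRep (i : Fin 8) : Nat.card (sectionRep i).1 = (sectionOrder i).1 ∧
    Nat.card (sectionRep i).2 = (sectionOrder i).2 := by
  have h1 : Nat.card (⊥ : Subgroup S3) = 1 := Subgroup.card_bot
  have h2 : Nat.card C2 = 2 := by
    rw [C2, Nat.card_zpowers]
    exact orderOf_eq_prime (by decide) (by decide)
  have h3 : Nat.card C3 = 3 := by
    rw [C3, nat_card_alternatingGroup]; simp [Nat.factorial]
  have h6 : Nat.card (⊤ : Subgroup S3) = 6 := by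
    rw [Subgroup.card_top, Nat.card_perm]; simp [Nat.factorial]
  fin_cases i
  exacts [⟨h1, h1⟩, ⟨h2, h2⟩, ⟨h3, h3⟩, ⟨h6, h6⟩, ⟨h2, h1⟩, ⟨h6, h3⟩, ⟨h3, h1⟩, ⟨h6, h1⟩]

theorem card_of_hasGoursatSections {L : Subgroup (S3 × S3)} {a b : Fin 8}
    (h : HasGoursatSections L (sectionRep a) (sectionRep b)) :
    (Nat.card (L.map (MonoidHom.fst S3 S3)), Nat.card L.goursatFst) = sectionOrder a ∧
    (Nat.card (L.map (MonoidHom.snd S3 S3)), Nat.card L.goursatSnd) = sectionOrder b := by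
  obtain ⟨⟨g, h1, h2⟩, ⟨k, h3, h4⟩⟩ := h
  have ha := card_sectionRep a
  have hb := card_sectionRep b
  rw [← h1, ← h2] at ha
  rw [← h3, ← h4] at hb
  simp only [← conjBy.eq_1, card_conjBy] at ha hb
  exact ⟨Prod.ext ha.1 ha.2, Prod.ext hb.1 hb.2⟩

/-- Sections of different index cannot be matched, which leaves the `22` labels. -/
theorem exists_label (L : Subgroup (S3 × S3)) : ∃ i, HasGoursatSections L
    (sectionRep (sectionLabel i).1) (sectionRep (sectionLabel i).2) := by
  obtain ⟨a, g, h1, h2⟩ := section_cases (L.map (MonoidHom.fst S3 S3)) L.goursatFst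
    (fun g hg => mem_map_fst.2 ⟨1, mem_goursatFst.1 hg⟩) (by
      intro p hp k hk
      obtain ⟨q, hq⟩ := mem_map_fst.1 hp
      rw [mem_goursatFst] at hk ⊢
      simpa using L.mul_mem (L.mul_mem hq hk) (L.inv_mem hq))
  obtain ⟨b, h, h3, h4⟩ := section_cases (L.map (MonoidHom.snd S3 S3)) L.goursatSnd
    (fun g hg => mem_map_snd.2 ⟨1, mem_goursatSnd.1 hg⟩) (by
      intro p hp k hk
      obtain ⟨q, hq⟩ := mem_map_snd.1 hp
      rw [mem_goursatSnd] at hk ⊢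
      simpa using L.mul_mem (L.mul_mem hq hk) (L.inv_mem hq))
  have hab : HasGoursatSections L (sectionRep a) (sectionRep b) := ⟨⟨g, h1, h2⟩, ⟨h, h3, h4⟩⟩
  have hc := card_of_hasGoursatSections hab
  have hL := (card_eq_fst L).symm.trans (card_eq_snd L)
  have key : ∀ a b : Fin 8,
      (sectionOrder b).2 * (sectionOrder a).1 = (sectionOrder a).2 * (sectionOrder b).1 →
      ∃ i, sectionLabel i = (a, b) := by decide
  obtain ⟨i, hi⟩ := key a b (by rw [← hc.1, ← hc.2]; exact hL)
  exact ⟨i, by rwa [hi]⟩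

/-! ### Representatives of the classes of subgroups -/

/-- The condition that links the two components of the elements of a representative: none,
equality of signs, or equality. -/
def link (i : Fin 22) : Subgroup (S3 × S3) :=
  if i < 16 then ⊤
  else if i < 20 then
    (Perm.sign.comp (MonoidHom.fst S3 S3)).eqLocus (Perm.sign.comp (MonoidHom.snd S3 S3))
  else (MonoidHom.fst S3 S3).eqLocus (MonoidHom.snd S3 S3)

/-- A representative of the `i`-th conjugacy class of subgroups. -/
def labelRep (i : Fin 22) : Subgroup (S3 × S3) :=
  (sectionRep (sectionLabel i).1).1.prod (sectionRep (sectionLabel i).2).1 ⊓ link i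

section

variable {L : Subgroup (S3 × S3)} {P Q : Subgroup S3}

theorem eq_prod (hP : L.map (MonoidHom.fst S3 S3) = P) (hQ : L.map (MonoidHom.snd S3 S3) = Q)
    (hK : L.goursatFst = P) (hM : L.goursatSnd = Q) : L = P.prod Q := by
  refine le_antisymm (fun p hp => ?_) ?_
  · exact ⟨hP ▸ mem_map_fst.2 ⟨p.2, hp⟩, hQ ▸ mem_map_snd.2 ⟨p.1, hp⟩⟩
  · rw [← hK, ← hM]
    exact goursatFst_prod_goursatSnd_le L

/-- If the intersections with `C3` are the bottom groups of both sections, the isomorphism of the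
quotients, which have order at most two, is the one that matches signs. -/
theorem eq_prod_inf_sign (hP : L.map (MonoidHom.fst S3 S3) = P)
    (hQ : L.map (MonoidHom.snd S3 S3) = Q) (hK : L.goursatFst = P ⊓ C3)
    (hM : L.goursatSnd = Q ⊓ C3) :
    L = P.prod Q ⊓
      (Perm.sign.comp (MonoidHom.fst S3 S3)).eqLocus (Perm.sign.comp (MonoidHom.snd S3 S3)) := by
  have hsign : ∀ p ∈ L, Perm.sign p.1 = Perm.sign p.2 := by
    rintro ⟨a, b⟩ hp
    have h1 : (a, 1) ∈ L ↔ (1, b) ∈ L := by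
      constructor
      · intro h; simpa using L.mul_mem (L.inv_mem h) hp
      · intro h; simpa using L.mul_mem hp (L.inv_mem h)
    have ha : a ∈ P := hP ▸ mem_map_fst.2 ⟨b, hp⟩
    have hb : b ∈ Q := hQ ▸ mem_map_snd.2 ⟨a, hp⟩
    rw [← mem_goursatFst, ← mem_goursatSnd, hK, hM, mem_inf, mem_inf, mem_C3, mem_C3,
      and_iff_right ha, and_iff_right hb] at h1
    rcases Int.units_eq_one_or (Perm.sign a) with h | h <;>
      rcases Int.units_eq_one_or (Perm.sign b) with k | k <;> simp_all
  ext p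
  constructor
  · intro hp
    exact ⟨⟨hP ▸ mem_map_fst.2 ⟨p.2, hp⟩, hQ ▸ mem_map_snd.2 ⟨p.1, hp⟩⟩, hsign p hp⟩
  · rintro ⟨⟨h1, h2⟩, h3⟩
    obtain ⟨q, hq⟩ := mem_map_fst.1 (hP.symm ▸ h1)
    have hq' : q ∈ Q := hQ ▸ mem_map_snd.2 ⟨p.1, hq⟩
    have h4 : Perm.sign p.1 = Perm.sign p.2 := h3
    have h5 : q⁻¹ * p.2 ∈ L.goursatSnd := by
      rw [hM, mem_inf, mem_C3]
      refine ⟨Q.mul_mem (Q.inv_mem hq') h2, ?_⟩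
      rw [map_mul, map_inv, ← h4, hsign _ hq, inv_mul_cancel]
    simpa using L.mul_mem hq (mem_goursatSnd.1 h5)

/-- If `L` is the graph of conjugation by `h⁻¹` on `P`, its conjugate by `(1, h)` is the diagonal
of `P`. -/
theorem conjBy_eq_graph {h : S3} (hP : L.map (MonoidHom.fst S3 S3) = P)
    (hM : L.goursatSnd = ⊥) (hL : ∀ p ∈ P, (p, h⁻¹ * p * h) ∈ L) :
    L.conjBy (1, h) =
      P.prod P ⊓ (MonoidHom.fst S3 S3).eqLocus (MonoidHom.snd S3 S3) := by
  ext ⟨p, q⟩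
  simp only [mem_conjBy, Prod.inv_mk, Prod.mk_mul_mk, inv_one, one_mul, mul_one]
  constructor
  · intro hpq
    have hp : p ∈ P := hP ▸ mem_map_fst.2 ⟨_, hpq⟩
    have h1 : (h⁻¹ * p * h)⁻¹ * (h⁻¹ * q * h) ∈ L.goursatSnd := by
      rw [mem_goursatSnd]
      simpa using L.mul_mem (L.inv_mem (hL p hp)) hpq
    rw [hM, mem_bot, inv_mul_eq_one, mul_left_inj, mul_right_inj] at h1
    exact ⟨⟨hp, h1 ▸ hp⟩, h1⟩
  · rintro ⟨⟨hp, -⟩, h1⟩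
    obtain rfl : p = q := h1
    exact hL p hp

end

theorem exists_conj_r : ∀ x : S3, x ≠ 1 → x * x * x = 1 → ∃ h : S3, x = h⁻¹ * r * h := by decide

set_option synthInstance.maxHeartbeats 200000 in
theorem exists_conj_r_s : ∀ x y : S3, (x ≠ 1 ∧ y ≠ 1) ∧ (x * x * x = 1 ∧ y * y = 1) →
    ∃ h : S3, x = h⁻¹ * r * h ∧ y = h⁻¹ * s * h := by decide

theorem eq_word : ∀ p : S3, p = 1 ∨ p = r ∨ p = r * r ∨ p = s ∨ p = r * s ∨ p = r * r * s := by
  decide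

/-- The image of a three-cycle under the automorphism of `C3` with graph `L` is a three-cycle, and
all three-cycles are conjugate in `S₃`. -/
theorem exists_conjBy_eq_graph_C3 {L : Subgroup (S3 × S3)}
    (hP : L.map (MonoidHom.fst S3 S3) = C3) (hK : L.goursatFst = ⊥) (hM : L.goursatSnd = ⊥) :
    ∃ h, L.conjBy (1, h) =
      C3.prod C3 ⊓ (MonoidHom.fst S3 S3).eqLocus (MonoidHom.snd S3 S3) := by
  have hne : ∀ p ≠ 1, (p, 1) ∉ L := fun p hp h => hp (by
    rwa [← mem_goursatFst, hK, mem_bot] at h)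
  have heq : ∀ q, (1, q) ∈ L → q = 1 := fun q h => by rwa [← mem_goursatSnd, hM, mem_bot] at h
  have hrC : r ∈ C3 := mem_C3.2 (by decide)
  obtain ⟨x, hx⟩ := mem_map_fst.1 (hP.symm ▸ hrC)
  obtain ⟨h, rfl⟩ := exists_conj_r x (by rintro rfl; exact hne r (by decide) hx)
    (heq _ (by simpa [show r * r * r = 1 by decide] using L.mul_mem (L.mul_mem hx hx) hx))
  refine ⟨h, conjBy_eq_graph hP hM fun p hp => ?_⟩
  rcases eq_of_sign_eq_one p (mem_C3.1 hp) with rfl | rfl | rfl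
  · simp only [mul_one, inv_mul_cancel]; exact L.one_mem
  · exact hx
  · simpa [mul_assoc] using L.inv_mem hx

/-- Automorphisms of `S₃` are inner: the images of the generators `r` and `s` under the automorphism
with graph `L` are simultaneously conjugate to `r` and `s`. -/
theorem exists_conjBy_eq_graph_top {L : Subgroup (S3 × S3)}
    (hP : L.map (MonoidHom.fst S3 S3) = ⊤) (hK : L.goursatFst = ⊥) (hM : L.goursatSnd = ⊥) :
    ∃ h, L.conjBy (1, h) = (⊤ : Subgroup S3).prod ⊤ ⊓
      (MonoidHom.fst S3 S3).eqLocus (MonoidHom.snd S3 S3) := by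
  have hne : ∀ p ≠ 1, (p, 1) ∉ L := fun p hp h => hp (by
    rwa [← mem_goursatFst, hK, mem_bot] at h)
  have heq : ∀ q, (1, q) ∈ L → q = 1 := fun q h => by rwa [← mem_goursatSnd, hM, mem_bot] at h
  obtain ⟨x, hx⟩ := mem_map_fst.1 (hP.symm ▸ mem_top r)
  obtain ⟨y, hy⟩ := mem_map_fst.1 (hP.symm ▸ mem_top s)
  obtain ⟨h, rfl, rfl⟩ := exists_conj_r_s x y ⟨⟨by rintro rfl; exact hne r (by decide) hx,
    by rintro rfl; exact hne s (by decide) hy⟩,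
    heq _ (by simpa [show r * r * r = 1 by decide] using L.mul_mem (L.mul_mem hx hx) hx),
    heq _ (by simpa [show s * s = 1 by decide] using L.mul_mem hy hy)⟩
  refine ⟨h, conjBy_eq_graph hP hM fun p _ => ?_⟩
  have hmul : ∀ p q, (p, h⁻¹ * p * h) ∈ L → (q, h⁻¹ * q * h) ∈ L →
      (p * q, h⁻¹ * (p * q) * h) ∈ L := fun p q h1 h2 => by
    simpa [mul_assoc] using L.mul_mem h1 h2
  rcases eq_word p with rfl | rfl | rfl | rfl | rfl | rfl
  · simp only [mul_one, inv_mul_cancel]; exact L.one_mem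
  · exact hx
  · exact hmul _ _ hx hx
  · exact hy
  · exact hmul _ _ hx hy
  · exact hmul _ _ (hmul _ _ hx hx) hy

/-- Subgroups with the same label are conjugate. -/
theorem exists_conjBy_eq_labelRep {L : Subgroup (S3 × S3)} {i : Fin 22}
    (h : HasGoursatSections L (sectionRep (sectionLabel i).1) (sectionRep (sectionLabel i).2)) :
    ∃ p, L.conjBy p = labelRep i := by
  obtain ⟨⟨g, h1, h2⟩, ⟨k, h3, h4⟩⟩ := h
  simp only [← conjBy.eq_1] at h1 h2 h3 h4
  rw [← map_fst_conjBy L (g, k)] at h1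
  rw [← goursatFst_conjBy L (g, k)] at h2
  rw [← map_snd_conjBy L (g, k)] at h3
  rw [← goursatSnd_conjBy L (g, k)] at h4
  suffices ∃ p, (L.conjBy (g, k)).conjBy p = labelRep i by
    obtain ⟨p, hp⟩ := this
    exact ⟨p * (g, k), by rw [conjBy_mul, hp]⟩
  generalize L.conjBy (g, k) = L at *
  rcases lt_or_ge i 16 with hi | hi
  · have : ∀ i : Fin 22, i < 16 →
        ((sectionLabel i).1 < 4) ∧ ((sectionLabel i).2 < 4) := by decide
    have h5 : ∀ a : Fin 8, a < 4 → (sectionRep a).2 = (sectionRep a).1 := by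
      intro a ha; fin_cases a <;> first | rfl | exact absurd ha (by decide)
    rw [h5 _ (this i hi).1] at h2
    rw [h5 _ (this i hi).2] at h4
    refine ⟨1, ?_⟩
    rw [conjBy_one, labelRep, link, if_pos hi, inf_top_eq]
    exact eq_prod h1 h3 h2 h4
  rcases lt_or_ge i 20 with hi' | hi'
  · have : ∀ i : Fin 22, 16 ≤ i → i < 20 →
        ((sectionLabel i).1 = 4 ∨ (sectionLabel i).1 = 5) ∧
        ((sectionLabel i).2 = 4 ∨ (sectionLabel i).2 = 5) := by decide
    have h6 : (⊥ : Subgroup S3) = C2 ⊓ C3 := by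
      refine (Subgroup.eq_bot_iff_forall _).2 (fun x hx => ?_) |>.symm
      rcases mem_C2.1 hx.1 with rfl | rfl
      · rfl
      · exact absurd (mem_C3.1 hx.2) (by decide)
    have h5 : ∀ a : Fin 8, a = 4 ∨ a = 5 → (sectionRep a).2 = (sectionRep a).1 ⊓ C3 := by
      rintro a (rfl | rfl)
      · exact h6
      · exact (top_inf_eq C3).symm
    rw [h5 _ (this i hi hi').1] at h2
    rw [h5 _ (this i hi hi').2] at h4
    refine ⟨1, ?_⟩
    rw [conjBy_one, labelRep, link, if_neg (not_lt.2 hi), if_pos hi']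
    exact eq_prod_inf_sign h1 h3 h2 h4
  · have : ∀ i : Fin 22, 20 ≤ i → i = 20 ∨ i = 21 := by decide
    rcases this i hi' with rfl | rfl
    · obtain ⟨h, hh⟩ := exists_conjBy_eq_graph_C3 h1 h2 h4
      exact ⟨(1, h), hh⟩
    · obtain ⟨h, hh⟩ := exists_conjBy_eq_graph_top h1 h2 h4
      exact ⟨(1, h), hh⟩

end S3

namespace S3

open Equiv Subgroup

/-! ### Labels and scaled marks -/

/-- The index in `sectionRep` of a section with groups of orders `p` and `k`; the value `7` for
pairs other than `(6, 1)` that are not orders of a section is irrelevant. -/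
def sectionIndex (p k : ℕ) : ℕ :=
  match p, k with
  | 1, 1 => 0
  | 2, 2 => 1
  | 3, 3 => 2
  | 6, 6 => 3
  | 2, 1 => 4
  | 6, 3 => 5
  | 3, 1 => 6
  | _, _ => 7

/-- The position in `sectionLabel` of the label `(a, b)`. -/
def labelIndex (a b : ℕ) : ℕ :=
  bif a.blt 4 then 4 * a + b else bif a.blt 6 then 2 * a + b + 4 else a + 14

/-- The label of a subgroup of `S₃ × S₃`, which is determined by the orders of the groups in its
Goursat sections. -/
noncomputable def label (L : Subgroup (S3 × S3)) : ℕ :=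
  labelIndex (sectionIndex (Nat.card (L.map (MonoidHom.fst S3 S3))) (Nat.card L.goursatFst))
    (sectionIndex (Nat.card (L.map (MonoidHom.snd S3 S3))) (Nat.card L.goursatSnd))

theorem label_eq {L : Subgroup (S3 × S3)} {i : Fin 22}
    (h : HasGoursatSections L (sectionRep (sectionLabel i).1) (sectionRep (sectionLabel i).2)) :
    label L = i := by
  have hc := card_of_hasGoursatSections h
  simp only [Prod.ext_iff] at hc
  rw [label, hc.1.1, hc.1.2, hc.2.1, hc.2.2]
  clear h hc
  revert i
  decide

theorem label_conjBy (L : Subgroup (S3 × S3)) (p : S3 × S3) : label (L.conjBy p) = label L := by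
  obtain ⟨i, hi⟩ := exists_label L
  rw [label_eq hi, label_eq (hi.conjBy p)]

/-- The rows of the modified table of marks, multiplied by the orders of the subgroups. -/
def scaledMarks : List (List ℕ) :=
  [[6, 0, 0, 0, 0, 0, 0, 0, 0, 0, 0, 0, 0, 0, 0, 0, 0, 0, 0, 0, 0, 0],
   [6, 2, 0, 0, 0, 0, 0, 0, 0, 0, 0, 0, 0, 0, 0, 0, 0, 0, 0, 0, 0, 0],
   [6, 0, 6, 0, 0, 0, 0, 0, 0, 0, 0, 0, 0, 0, 0, 0, 0, 0, 0, 0, 0, 0],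
   [6, 6, 6, 6, 0, 0, 0, 0, 0, 0, 0, 0, 0, 0, 0, 0, 0, 0, 0, 0, 0, 0],
   [6, 0, 0, 0, 6, 0, 0, 0, 0, 0, 0, 0, 0, 0, 0, 0, 0, 0, 0, 0, 0, 0],
   [6, 2, 0, 0, 6, 2, 0, 0, 0, 0, 0, 0, 0, 0, 0, 0, 0, 0, 0, 0, 0, 0],
   [6, 0, 6, 0, 6, 0, 6, 0, 0, 0, 0, 0, 0, 0, 0, 0, 0, 0, 0, 0, 0, 0],
   [6, 6, 6, 6, 6, 6, 6, 6, 0, 0, 0, 0, 0, 0, 0, 0, 0, 0, 0, 0, 0, 0],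
   [6, 0, 0, 0, 0, 0, 0, 0, 12, 0, 0, 0, 0, 0, 0, 0, 0, 0, 0, 0, 0, 0],
   [6, 2, 0, 0, 0, 0, 0, 0, 12, 4, 0, 0, 0, 0, 0, 0, 0, 0, 0, 0, 0, 0],
   [6, 0, 6, 0, 0, 0, 0, 0, 12, 0, 12, 0, 0, 0, 0, 0, 0, 0, 0, 0, 0, 0],
   [6, 6, 6, 6, 0, 0, 0, 0, 12, 12, 12, 12, 0, 0, 0, 0, 0, 0, 0, 0, 0, 0],
   [6, 0, 0, 0, 18, 0, 0, 0, 12, 0, 0, 0, 36, 0, 0, 0, 0, 0, 0, 0, 0, 0],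
   [6, 2, 0, 0, 18, 6, 0, 0, 12, 4, 0, 0, 36, 12, 0, 0, 0, 0, 0, 0, 0, 0],
   [6, 0, 6, 0, 18, 0, 18, 0, 12, 0, 12, 0, 36, 0, 36, 0, 0, 0, 0, 0, 0, 0],
   [6, 6, 6, 6, 18, 18, 18, 18, 12, 12, 12, 12, 36, 36, 36, 36, 0, 0, 0, 0, 0, 0],
   [6, 0, 0, 0, 0, 2, 0, 0, 0, 0, 0, 0, 0, 0, 0, 0, 2, 0, 0, 0, 0, 0],
   [6, 0, 6, 0, 0, 6, 0, 6, 0, 0, 0, 0, 0, 0, 0, 0, 6, 6, 0, 0, 0, 0],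
   [6, 0, 0, 0, 0, 6, 0, 0, 12, 0, 0, 0, 0, 12, 0, 0, 6, 0, 12, 0, 0, 0],
   [6, 0, 6, 0, 0, 18, 0, 18, 12, 0, 12, 0, 0, 36, 0, 36, 18, 18, 36, 36, 0, 0],
   [6, 0, 0, 0, 0, 0, 0, 0, 0, 0, 6, 0, 0, 0, 0, 0, 0, 0, 0, 0, 6, 0],
   [6, 0, 0, 0, 0, 6, 0, 0, 0, 0, 6, 0, 0, 0, 0, 0, 6, 0, 0, 0, 6, 6]]

/-- The entry of `scaledMarks` in row `i` and column `c`. -/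
def scaledMark (i c : ℕ) : ℕ := (scaledMarks.getD i []).getD c 0

/-- The order of a subgroup with label `i`. -/
def labelOrder (i : Fin 22) : ℕ :=
  (sectionOrder (sectionLabel i).1).1 * (sectionOrder (sectionLabel i).2).2

theorem labelOrder_mul_modifiedMarks : ∀ i j : Fin 22,
    (labelOrder i : ℚ) * modifiedMarks i j = scaledMark i j := by
  decide +kernel

theorem card_eq_labelOrder {L : Subgroup (S3 × S3)} {i : Fin 22}
    (h : HasGoursatSections L (sectionRep (sectionLabel i).1) (sectionRep (sectionLabel i).2)) :
    Nat.card L = labelOrder i := by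
  have hc := card_of_hasGoursatSections h
  simp only [Prod.ext_iff] at hc
  rw [card_eq_fst, hc.1.1, hc.2.2, labelOrder, mul_comm]

/-- The coordinates of the product of two ghost matrices with coordinates `x` and `y`. -/
def ghostMul {R : Type*} [Add R] [Mul R] (x y : ℕ → R) : List R :=
  [x 0 * y 0 + x 1 * y 4 + x 2 * y 8,
    x 0 * y 1 + x 1 * y 5 + x 2 * y 9,
    x 0 * y 2 + x 1 * y 6 + x 2 * y 10,
    x 0 * y 3 + x 1 * y 7 + x 2 * y 11 + x 3 * y 21,
    x 4 * y 0 + x 5 * y 4 + x 6 * y 8,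
    x 4 * y 1 + x 5 * y 5 + x 6 * y 9,
    x 4 * y 2 + x 5 * y 6 + x 6 * y 10,
    x 4 * y 3 + x 5 * y 7 + x 6 * y 11 + x 7 * y 21,
    x 8 * y 0 + x 9 * y 4 + x 10 * y 8,
    x 8 * y 1 + x 9 * y 5 + x 10 * y 9,
    x 8 * y 2 + x 9 * y 6 + x 10 * y 10,
    x 8 * y 3 + x 9 * y 7 + x 10 * y 11 + x 11 * y 21,
    x 12 * y 0 + x 13 * y 4 + x 14 * y 8 + x 21 * y 12,
    x 12 * y 1 + x 13 * y 5 + x 14 * y 9 + x 21 * y 13,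
    x 12 * y 2 + x 13 * y 6 + x 14 * y 10 + x 21 * y 14,
    x 12 * y 3 + x 13 * y 7 + x 14 * y 11 + x 15 * y 21 + x 21 * y 15,
    x 16 * y 16,
    x 16 * y 17 + x 17 * y 21,
    x 18 * y 16 + x 21 * y 18,
    x 18 * y 17 + x 19 * y 21 + x 21 * y 19,
    x 20 * y 20,
    x 21 * y 21]

set_option maxHeartbeats 1000000 in
theorem ghostMatrix_mul (x y : ℕ → ℚ) :
    ghostMatrix (fun c => x c) * ghostMatrix (fun c => y c) =
      ghostMatrix fun c => (ghostMul x y).getD c 0 := by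
  simp only [ghostMatrix, ghostMul, Fin.isValue, Fin.coe_ofNat_eq_mod, Nat.reduceMod,
    Nat.zero_mod, Nat.one_mod, List.getD_cons_zero, List.getD_cons_succ]
  ext i j
  rw [Matrix.mul_apply, Fin.sum_univ_eight]
  fin_cases i <;> fin_cases j <;>
    simp only [Matrix.of_apply, Matrix.cons_val, Matrix.cons_val', mul_zero, zero_mul, add_zero,
      zero_add, Fin.zero_eta, Fin.mk_one, Fin.reduceFinMk, Fin.isValue]

/-! ### Subgroups as bit masks -/

/-- The elements of `S₃`, in a fixed order that starts with the identity. -/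
def elt : Fin 6 → S3 := ![1, r, r * r, s, s * r, s * r * r]

theorem elt_bijective : Function.Bijective elt := by decide

/-- The index of `h⁻¹ b h`. -/
def conjIndex (h b : Fin 6) : Fin 6 :=
  (([[0, 1, 2, 3, 4, 5], [0, 1, 2, 5, 3, 4], [0, 1, 2, 4, 5, 3], [0, 2, 1, 3, 5, 4],
    [0, 2, 1, 5, 4, 3], [0, 2, 1, 4, 3, 5]] : List (List (Fin 6))).getD h []).getD b 0

theorem elt_conjIndex : ∀ h b, elt (conjIndex h b) = (elt h)⁻¹ * elt b * elt h := by decide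

/-- A family `m` of six numbers describes the subgroup whose elements are the pairs of the `a`-th
and the `b`-th element of `S₃` such that bit `b` of `m a` is set. -/
def IsMask (m : Fin 6 → ℕ) (S : Subgroup (S3 × S3)) : Prop :=
  ∀ a b : Fin 6, (elt a, elt b) ∈ S ↔ (m a).testBit b = true

/-- The sum of six numbers. -/
def sum6 (f : Fin 6 → ℕ) : ℕ := f 0 + f 1 + f 2 + f 3 + f 4 + f 5

/-- The bitwise disjunction of six numbers. -/
def or6 (f : Fin 6 → ℕ) : ℕ := f 0 ||| f 1 ||| f 2 ||| f 3 ||| f 4 ||| f 5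

/-- The number of bits among the lowest six that are set. -/
def bits (x : ℕ) : ℕ := sum6 fun b => (x.testBit b).toNat

theorem testBit_or6 (f : Fin 6 → ℕ) (c : ℕ) :
    (or6 f).testBit c = true ↔ ∃ b, (f b).testBit c = true := by
  simp [or6, Nat.testBit_or, Fin.exists_fin_succ, or_assoc]

theorem exists_elt {p : S3 → Prop} : (∃ g, p g) ↔ ∃ a, p (elt a) :=
  (elt_bijective.surjective.exists)

theorem sum_elt {A : Type*} [AddCommMonoid A] (f : S3 → A) : ∑ g, f g = ∑ a, f (elt a) :=
  (Fintype.sum_bijective elt elt_bijective _ _ fun _ => rfl).symm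

theorem card_eq_sum6 (p : S3 → Prop) (f : Fin 6 → Bool) (h : ∀ a, p (elt a) ↔ f a = true) :
    Nat.card {g // p g} = sum6 fun a => (f a).toNat := by
  classical
  rw [Nat.card_eq_fintype_card, Fintype.card_subtype, Finset.card_filter, sum_elt,
    Fin.sum_univ_six, sum6]
  have key : ∀ a, (if p (elt a) then 1 else 0) = (f a).toNat := fun a => by
    rcases hf : f a <;> simp [h, hf]
  simp only [key]

theorem mod_ne_zero_iff (x : ℕ) : (!(x % 64).beq 0) = true ↔ ∃ b : Fin 6, x.testBit b = true := by
  have h1 : ∀ y : Fin 64, (!(y : ℕ).beq 0) = true ↔ ∃ b : Fin 6, (y : ℕ).testBit b = true := by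
    decide
  refine (h1 ⟨x % 64, Nat.mod_lt _ (by decide)⟩).trans ?_
  refine exists_congr fun b => ?_
  change (x % 2 ^ 6).testBit b = true ↔ _
  rw [Nat.testBit_mod_two_pow]
  simp

/-- The value `f n`, in a form that makes the kernel evaluate `n` before it unfolds `f`, so that
the value of `f` at a given number is computed only once. -/
def force {α : Type} (n : ℕ) (f : ℕ → α) : α := Nat.rec (f 0) (fun k _ => f (k + 1)) n

theorem force_eq {α : Type} (n : ℕ) (f : ℕ → α) : force n f = f n := by
  cases n <;> rfl

/-- The label of the subgroup described by a mask. -/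
def maskLabel (m : Fin 6 → ℕ) : ℕ :=
  force (force (sum6 fun a => force (m a) fun x => (!(x % 64).beq 0).toNat) fun p =>
    force (sum6 fun a => force (m a) fun x => (x.testBit 0).toNat) fun k => sectionIndex p k)
  fun a => force (force (force (or6 m) bits) fun p =>
    force (force (m 0) bits) fun k => sectionIndex p k) fun b => labelIndex a b

theorem IsMask.label_eq {m : Fin 6 → ℕ} {S : Subgroup (S3 × S3)} (h : IsMask m S) :
    label S = maskLabel m := by
  have h0 : elt 0 = 1 := rfl
  simp only [label, maskLabel, force_eq]
  congr 2
  · refine card_eq_sum6 (· ∈ S.map (MonoidHom.fst S3 S3)) _ fun a => ?_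
    rw [mod_ne_zero_iff, mem_map_fst, exists_elt]
    exact exists_congr fun b => h a b
  · refine card_eq_sum6 (· ∈ S.goursatFst) (fun a => (m a).testBit 0) fun a => ?_
    rw [mem_goursatFst, ← h0, h a 0]; rfl
  · refine card_eq_sum6 (· ∈ S.map (MonoidHom.snd S3 S3)) (fun b => (or6 m).testBit b) fun b => ?_
    rw [testBit_or6, mem_map_snd, exists_elt]
    exact exists_congr fun a => h a b
  · refine card_eq_sum6 (· ∈ S.goursatSnd) (fun b => (m 0).testBit b) fun b => ?_
    rw [mem_goursatSnd, ← h0, h 0 b]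

/-- The mask of the composite of two subgroups. -/
def maskComp (m n : Fin 6 → ℕ) (a : Fin 6) : ℕ :=
  force (m a) fun x => or6 fun b => bif x.testBit b then n b else 0

theorem IsMask.relComp {m n : Fin 6 → ℕ} {S T : Subgroup (S3 × S3)} (hm : IsMask m S)
    (hn : IsMask n T) : IsMask (maskComp m n) (S.relComp T) := by
  intro a c
  rw [mem_relComp, maskComp, force_eq, testBit_or6, exists_elt]
  refine exists_congr fun b => ?_
  rw [hm a b, hn b c]
  cases (m a).testBit b <;> simp

theorem IsMask.conjBy {m : Fin 6 → ℕ} {S : Subgroup (S3 × S3)} (hm : IsMask m S) (h : Fin 6) :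
    IsMask (fun b => m (conjIndex h b)) (S.conjBy (elt h, 1)) := by
  intro a b
  rw [mem_conjBy, ← hm, elt_conjIndex]
  simp

/-- The value of `Subgroup.overlap` in terms of masks. -/
def maskOverlap (m n : Fin 6 → ℕ) : ℕ :=
  sum6 fun b => ((m 0).testBit b && (n b).testBit 0).toNat

theorem IsMask.overlap {m n : Fin 6 → ℕ} {S T : Subgroup (S3 × S3)} (hm : IsMask m S)
    (hn : IsMask n T) : S.overlap T = maskOverlap m n := by
  refine card_eq_sum6 _ (fun b => (m 0).testBit b && (n b).testBit 0) fun b => ?_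
  rw [Bool.and_eq_true]
  exact and_congr (hm 0 b) (hn b 0)

/-- The masks of the representatives `labelRep`. -/
def labelMask (i : Fin 22) (a : Fin 6) : ℕ :=
  (([[1, 0, 0, 0, 0, 0], [9, 0, 0, 0, 0, 0], [7, 0, 0, 0, 0, 0], [63, 0, 0, 0, 0, 0],
    [1, 0, 0, 1, 0, 0], [9, 0, 0, 9, 0, 0], [7, 0, 0, 7, 0, 0], [63, 0, 0, 63, 0, 0],
    [1, 1, 1, 0, 0, 0], [9, 9, 9, 0, 0, 0], [7, 7, 7, 0, 0, 0], [63, 63, 63, 0, 0, 0],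
    [1, 1, 1, 1, 1, 1], [9, 9, 9, 9, 9, 9], [7, 7, 7, 7, 7, 7], [63, 63, 63, 63, 63, 63],
    [1, 0, 0, 8, 0, 0], [7, 0, 0, 56, 0, 0], [1, 1, 1, 8, 8, 8], [7, 7, 7, 56, 56, 56],
    [1, 2, 4, 0, 0, 0], [1, 2, 4, 8, 16, 32]] : List (List ℕ)).getD i []).getD a 0

theorem mem_sectionRep (p : S3) (a : Fin 8) : p ∈ (sectionRep a).1 ↔
    ((a = 0 → p = 1) ∧ (a = 1 ∨ a = 4 → p = 1 ∨ p = s) ∧ (a = 2 ∨ a = 6 → Perm.sign p = 1)) := by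
  fin_cases a
  · exact ⟨fun h => ⟨fun _ => h, by simp, by simp⟩, fun h => h.1 rfl⟩
  · exact mem_C2.trans (by simp)
  · exact mem_C3.trans (by simp)
  · exact ⟨fun _ => by simp, fun _ => trivial⟩
  · exact mem_C2.trans (by simp)
  · exact ⟨fun _ => by simp, fun _ => trivial⟩
  · exact mem_C3.trans (by simp)
  · exact ⟨fun _ => by simp, fun _ => trivial⟩

theorem mem_link (p : S3 × S3) (i : Fin 22) : p ∈ link i ↔
    i < 16 ∨ (i < 20 ∧ Perm.sign p.1 = Perm.sign p.2) ∨ p.1 = p.2 := by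
  rw [link]
  split_ifs with h1 h2
  · simp [h1]
  · simp only [h1, h2, false_or, true_and]
    change Perm.sign p.1 = Perm.sign p.2 ↔ _
    exact ⟨Or.inl, fun h => h.elim id fun h => congrArg Perm.sign h⟩
  · simp only [h1, h2, false_or, false_and]
    rfl

theorem isMask_labelRep (i : Fin 22) : IsMask (labelMask i) (labelRep i) := by
  intro a b
  rw [labelRep, mem_inf, mem_prod, mem_sectionRep, mem_sectionRep, mem_link]
  revert i a b
  decide +kernel

/-- The `c`-th coordinate of the sum over `h` that the multiplicativity criterion asks for. -/
def maskSum (m n : Fin 6 → ℕ) (c : ℕ) : ℕ :=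
  sum6 fun h => force (maskOverlap m fun b => n (conjIndex h b)) fun k =>
    force (maskLabel (maskComp m fun b => n (conjIndex h b))) fun l => k * scaledMark l c

/-- The multiplicativity criterion for the representatives: a finite computation with the `22 · 22`
pairs of representatives and the six elements of `S₃`. -/
theorem map_maskSum_eq_ghostMul : ∀ i j : Fin 22,
    (List.range 22).map (maskSum (labelMask i) (labelMask j)) =
      ghostMul (scaledMark i) (scaledMark j) := by
  decide +kernel

theorem maskSum_eq_ghostMul (i j c : Fin 22) : maskSum (labelMask i) (labelMask j) c =
    (ghostMul (scaledMark i) (scaledMark j)).getD c 0 := by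
  rw [← map_maskSum_eq_ghostMul, List.getD_eq_getElem _ _ (by simp)]
  simp

end S3

namespace S3

open Equiv Subgroup

theorem eq_conjBy_labelRep (S : Subgroup (S3 × S3)) : ∃ i p, S = (labelRep i).conjBy p := by
  obtain ⟨i, hi⟩ := exists_label S
  obtain ⟨p, hp⟩ := exists_conjBy_eq_labelRep hi
  exact ⟨i, p⁻¹, by rw [← hp, ← conjBy_mul, inv_mul_cancel, conjBy_one]⟩

theorem label_labelRep (i : Fin 22) : label (labelRep i) = i := by
  rw [(isMask_labelRep i).label_eq]
  revert i
  decide +kernel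

theorem sum_overlap_labelRep (i j c : Fin 22) :
    ∑ h : S3, (labelRep i).overlap ((labelRep j).conjBy (h, 1)) *
      scaledMark (label ((labelRep i).relComp ((labelRep j).conjBy (h, 1)))) c =
    (ghostMul (scaledMark i) (scaledMark j)).getD c 0 := by
  rw [← maskSum_eq_ghostMul, sum_elt, Fin.sum_univ_six, maskSum, sum6]
  have hi := isMask_labelRep i
  have hj := fun h => (isMask_labelRep j).conjBy h
  simp only [force_eq, hi.overlap (hj _), (hi.relComp (hj _)).label_eq]

/-- Summed over all `h`, the relational composites of `S` with the conjugates of `T` depend only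
on the conjugacy classes of `S` and `T`, so that representatives suffice. -/
theorem sum_overlap (S T : Subgroup (S3 × S3)) (c : Fin 22) :
    ∑ h : S3, S.overlap (T.conjBy (h, 1)) *
      scaledMark (label (S.relComp (T.conjBy (h, 1)))) c =
    (ghostMul (scaledMark (label S)) (scaledMark (label T))).getD c 0 := by
  obtain ⟨i, ⟨a, b⟩, rfl⟩ := eq_conjBy_labelRep S
  obtain ⟨j, ⟨d, e⟩, rfl⟩ := eq_conjBy_labelRep T
  rw [label_conjBy, label_conjBy, label_labelRep, label_labelRep, ← sum_overlap_labelRep]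
  refine Fintype.sum_equiv ((Equiv.mulLeft b⁻¹).trans (Equiv.mulRight d)) _ _ fun h => ?_
  have h1 : ((labelRep j).conjBy (d, e)).conjBy (h, 1) =
      ((labelRep j).conjBy (b⁻¹ * h * d, 1)).conjBy (b, e) := by
    rw [← conjBy_mul, ← conjBy_mul]; simp [mul_assoc]
  rw [h1, overlap_conjBy, relComp_conjBy, label_conjBy]
  rfl

/-! ### The mark homomorphism -/

/-- `ghostMatrix` as a linear map. -/
def ghostLinear : (Fin 22 → ℚ) →ₗ[ℚ] Matrix (Fin 8) (Fin 8) ℚ where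
  toFun := ghostMatrix
  map_add' x y := by simp [ghostMatrix]
  map_smul' q x := by simp [ghostMatrix]

theorem ghostMatrix_injective : Function.Injective ghostMatrix := by
  intro x y h
  have key : ∀ i j, ghostMatrix x i j = ghostMatrix y i j := fun i j => by rw [h]
  ext c
  fin_cases c
  exacts [key 0 0, key 0 1, key 0 2, key 0 3, key 1 0, key 1 1, key 1 2, key 1 3,
    key 2 0, key 2 1, key 2 2, key 2 3, key 7 0, key 7 1, key 7 2, key 7 3,
    key 4 4, key 4 5, key 7 4, key 7 5, key 6 6, key 7 7]

/-- The contribution of a point with stabilizer `S` to the coordinates `x₁, …, x₂₂`: the row of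
`M'` that belongs to `S`, times `|S| / 36`, since the orbit of the point has `36 / |S|` elements. -/
noncomputable def pointMark (S : Subgroup (S3 × S3)) : Fin 22 → ℚ :=
  fun c => (36 : ℚ)⁻¹ * scaledMark (label S) c

theorem pointMark_conjBy (p : S3 × S3) (S : Subgroup (S3 × S3)) :
    pointMark (S.conjBy p) = pointMark S := by
  ext c
  simp only [pointMark, label_conjBy]

theorem total_ghostLinear_tensor (X Y : Biset S3 S3) :
    Biset.total (fun S => ghostLinear (pointMark S)) (Biset.tensor X Y) =
      Biset.total (fun S => ghostLinear (pointMark S)) X *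
        Biset.total (fun S => ghostLinear (pointMark S)) Y := by
  refine Biset.total_tensor _ (fun S T => ?_) X Y
  have h1 (S : Subgroup (S3 × S3)) : ghostLinear (pointMark S) =
      (36 : ℚ)⁻¹ • ghostMatrix fun c => (scaledMark (label S) c : ℚ) :=
    map_smul ghostLinear (36 : ℚ)⁻¹ fun c : Fin 22 => (scaledMark (label S) c : ℚ)
  have h2 : Fintype.card S3 = 6 := by rw [Fintype.card_perm]; rfl
  rw [h1 S, h1 T, smul_mul_smul_comm,
    ghostMatrix_mul (fun k => (scaledMark (label S) k : ℚ)) fun k => (scaledMark (label T) k : ℚ),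
    h2]
  have h4 (z : Fin 22 → ℚ) : ghostMatrix z = ghostLinear z := rfl
  rw [h4]
  simp only [← map_nsmul, ← map_smul, ← map_sum]
  refine congrArg ghostLinear ?_
  ext c
  have h3 : (ghostMul (fun k => (scaledMark (label S) k : ℚ))
      fun k => (scaledMark (label T) k : ℚ)).getD c 0 =
      ((ghostMul (scaledMark (label S)) (scaledMark (label T))).getD c 0 : ℕ) := by
    fin_cases c <;> simp [ghostMul]
  simp only [Finset.sum_apply, Pi.smul_apply, pointMark, h3, ← sum_overlap]
  simp only [nsmul_eq_mul, smul_eq_mul, Nat.cast_sum, Nat.cast_mul, Finset.mul_sum]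
  refine Finset.sum_congr rfl fun h _ => ?_
  push_cast
  ring

/-- The coordinates `x₁, …, x₂₂` as a linear map. -/
noncomputable def coords : RatDoubleBurnside S3 →ₗ[ℚ] (Fin 22 → ℚ) :=
  RatDoubleBurnside.totalMap pointMark

theorem coords_coset {L : Subgroup (S3 × S3)} {i : Fin 22}
    (h : HasGoursatSections L (sectionRep (sectionLabel i).1) (sectionRep (sectionLabel i).2)) :
    coords (bisetElement (Biset.coset L)) = modifiedMarks i := by
  rw [coords, RatDoubleBurnside.totalMap_bisetElement,
    Biset.total_coset pointMark pointMark_conjBy]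
  have h1 : (L.index : ℚ) * labelOrder i = 36 := by
    rw [← card_eq_labelOrder h, ← Nat.cast_mul, Subgroup.index_mul_card, Nat.card_prod,
      Nat.card_perm]
    norm_num [Nat.factorial]
  ext c
  rw [Pi.smul_apply, pointMark, label_eq h, ← labelOrder_mul_modifiedMarks, nsmul_eq_mul,
    mul_left_comm, ← mul_assoc (L.index : ℚ), h1]
  ring

theorem ghostMatrix_modifiedMarks_last : ghostMatrix (modifiedMarks 21) = 1 := by
  decide +kernel

/-- The regular biset is the coset biset of the diagonal, the last of the representatives. -/
theorem coords_one : coords 1 = modifiedMarks 21 := by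
  have h1 : (Biset.regular S3).stab (1 : S3) = labelRep 21 := by
    ext ⟨a, b⟩
    have h2 : (a, b) ∈ (Biset.regular S3).stab (1 : S3) ↔ a * 1 = 1 * b := Iff.rfl
    rw [h2, mul_one, one_mul]
    exact ⟨fun h => ⟨⟨trivial, trivial⟩, h⟩, fun h => h.2⟩
  have h3 : Biset.Iso (Biset.coset (labelRep 21)) (Biset.regular S3) := by
    rw [← h1]
    refine Biset.coset_stab_iso _ _ fun (y : S3) => ⟨(y, 1), ?_⟩
    change y * (1 * (1 : S3)⁻¹) = y
    simp
  have h4 : (1 : RatDoubleBurnside S3) = bisetElement (Biset.coset (labelRep 21)) := by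
    rw [bisetElement, (BisetClass.mk_eq_iff _ _).2 h3]; rfl
  obtain ⟨i, hi⟩ := exists_label (labelRep 21)
  obtain rfl : i = 21 := Fin.ext ((label_eq hi).symm.trans (label_labelRep 21))
  rw [h4, coords_coset hi]

theorem ghostLinear_coords_mul (a b : RatDoubleBurnside S3) :
    ghostLinear (coords (a * b)) = ghostLinear (coords a) * ghostLinear (coords b) := by
  have h1 : ghostLinear ∘ₗ coords =
      RatDoubleBurnside.totalMap fun S => ghostLinear (pointMark S) := by
    refine LinearMap.ext_on RatDoubleBurnside.span_bisetElement ?_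
    rintro _ ⟨X, rfl⟩
    rw [LinearMap.comp_apply, coords, RatDoubleBurnside.totalMap_bisetElement,
      RatDoubleBurnside.totalMap_bisetElement]
    exact AddMonoidHom.map_finsum ghostLinear.toAddMonoidHom (Set.toFinite _)
  have h2 (x : RatDoubleBurnside S3) : ghostLinear (coords x) =
      RatDoubleBurnside.totalMap (fun S => ghostLinear (pointMark S)) x :=
    LinearMap.congr_fun h1 x
  rw [h2, h2, h2, RatDoubleBurnside.totalMap_mul _ total_ghostLinear_tensor]

/-- The mark homomorphism `β'`: the coordinates of an element, arranged in a ghost matrix. -/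
noncomputable def markHom : RatDoubleBurnside S3 →ₐ[ℚ] Matrix (Fin 8) (Fin 8) ℚ :=
  AlgHom.ofLinearMap (ghostLinear ∘ₗ coords)
    (by rw [LinearMap.comp_apply, coords_one]; exact ghostMatrix_modifiedMarks_last)
    ghostLinear_coords_mul

theorem isUnit_det_modifiedMarks : IsUnit modifiedMarks.det := by
  have h1 : ∀ i j : Fin 22, i < j → scaledMark i j = 0 := by decide +kernel
  have h2 : ∀ i : Fin 22, scaledMark i i ≠ 0 ∧ labelOrder i ≠ 0 := by decide +kernel
  have h3 (i j : Fin 22) : modifiedMarks i j = (scaledMark i j : ℚ) / labelOrder i := by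
    rw [eq_div_iff (Nat.cast_ne_zero.2 (h2 i).2), mul_comm, labelOrder_mul_modifiedMarks]
  rw [Matrix.det_of_isLowerTriangular _ fun i j h => by
    rw [h3, h1 i j h, Nat.cast_zero, zero_div]]
  refine (Finset.prod_ne_zero_iff.2 fun i _ => ?_).isUnit
  rw [h3]
  exact div_ne_zero (Nat.cast_ne_zero.2 (h2 i).1) (Nat.cast_ne_zero.2 (h2 i).2)

theorem linearIndependent_modifiedMarks : LinearIndependent ℚ fun i => modifiedMarks i :=
  Matrix.linearIndependent_rows_of_isUnit
    ((Matrix.isUnit_iff_isUnit_det _).2 isUnit_det_modifiedMarks)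

/-- Linear equations with matrix `M'` over a vector space have at most one solution. -/
theorem eq_of_sum_modifiedMarks {V : Type*} [AddCommGroup V] [Module ℚ V] {c d : Fin 22 → V}
    (h : ∀ i, ∑ j, modifiedMarks i j • c j = ∑ j, modifiedMarks i j • d j) : c = d := by
  have key (c : Fin 22 → V) (k : Fin 22) :
      ∑ i, modifiedMarks⁻¹ k i • ∑ j, modifiedMarks i j • c j = c k := by
    simp only [Finset.smul_sum, smul_smul]
    rw [Finset.sum_comm]
    simp only [← Finset.sum_smul, ← Matrix.mul_apply,
      Matrix.nonsing_inv_mul _ isUnit_det_modifiedMarks, Matrix.one_apply, ite_smul, one_smul,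
      zero_smul, Finset.sum_ite_eq, Finset.mem_univ, if_true]
  ext k
  rw [← key c, ← key d]
  simp only [h]

end S3

theorem mainTheorem10 (L : Fin 22 → Subgroup (S3 × S3))
    (hL : ∀ i, HasGoursatSections (L i)
      (sectionRep (sectionLabel i).1) (sectionRep (sectionLabel i).2)) :
    IsUnit modifiedMarks.det ∧
    ∃ b : Module.Basis (Fin 22) ℚ (RatDoubleBurnside S3),
      (∀ i, b i = bisetElement (Biset.coset (L i))) ∧
      ∃ c : Module.Basis (Fin 22) ℚ (RatDoubleBurnside S3),
        (∀ c' : Fin 22 → RatDoubleBurnside S3,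
          (∀ i, b i = ∑ j, modifiedMarks i j • c' j) ↔ c' = ⇑c) ∧
        ∃ β : RatDoubleBurnside S3 →ₐ[ℚ] Matrix (Fin 8) (Fin 8) ℚ,
          (∀ x : Fin 22 → ℚ, β (∑ i, x i • c i) = ghostMatrix x) ∧
          Function.Injective β := by
  refine ⟨S3.isUnit_det_modifiedMarks, ?_⟩
  have hconj (S : Subgroup (S3 × S3)) : ∃ i p, S = (L i).conjBy p := by
    obtain ⟨i, p, rfl⟩ := S3.eq_conjBy_labelRep S
    obtain ⟨q, hq⟩ := S3.exists_conjBy_eq_labelRep (hL i)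
    exact ⟨i, p * q, by rw [Subgroup.conjBy_mul, hq]⟩
  have hcoords (i : Fin 22) :
      S3.coords (bisetElement (Biset.coset (L i))) = modifiedMarks i :=
    S3.coords_coset (hL i)
  let b : Module.Basis (Fin 22) ℚ (RatDoubleBurnside S3) :=
    Module.Basis.mk (v := fun i => bisetElement (Biset.coset (L i)))
      (LinearIndependent.of_comp S3.coords (by
        simpa only [Function.comp_def, hcoords] using S3.linearIndependent_modifiedMarks))
      (RatDoubleBurnside.span_coset L hconj).ge
  have hb (i : Fin 22) : b i = bisetElement (Biset.coset (L i)) :=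
    Module.Basis.mk_apply _ _ i
  let m : Module.Basis (Fin 22) ℚ (Fin 22 → ℚ) :=
    basisOfLinearIndependentOfCardEqFinrank S3.linearIndependent_modifiedMarks (by simp)
  -- `coords` sends the basis `b` to the basis of rows of `M'`, and `c` to the standard basis.
  have he (x : RatDoubleBurnside S3) : b.equiv m (Equiv.refl _) x = S3.coords x := by
    refine LinearMap.congr_fun
      (f := (b.equiv m (Equiv.refl _)).toLinearMap) (b.ext fun i => ?_) x
    rw [LinearEquiv.coe_coe, Module.Basis.equiv_apply, hb, hcoords]
    simp [m]
  let c : Module.Basis (Fin 22) ℚ (RatDoubleBurnside S3) :=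
    Module.Basis.ofEquivFun (b.equiv m (Equiv.refl _))
  have hc (x : RatDoubleBurnside S3) : x = ∑ j, S3.coords x j • c j := by
    rw [← he]
    exact (c.sum_equivFun x).symm
  have hcx (x : Fin 22 → ℚ) : S3.coords (∑ j, x j • c j) = x := by
    rw [← he]
    exact (congrArg c.equivFun (c.equivFun_symm_apply x).symm).trans
      (c.equivFun.apply_symm_apply x)
  have hbc (i : Fin 22) : b i = ∑ j, modifiedMarks i j • c j := by
    have := hc (b i)
    rwa [hb, hcoords, ← hb] at this
  refine ⟨b, hb, c, fun c' => ⟨fun h => ?_, ?_⟩, S3.markHom, fun x => ?_, ?_⟩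
  · exact S3.eq_of_sum_modifiedMarks fun i => by rw [← h, hbc]
  · rintro rfl
    exact hbc
  · exact congrArg ghostMatrix (hcx x)
  · intro x y h
    have h1 := S3.ghostMatrix_injective h
    exact (b.equiv m (Equiv.refl _)).injective (by rw [he, he]; exact h1)
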